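/- **Setting.** Let $p$ be a prime, $D\subset\mathbb N_+$ a finite non-empty set, $k$ a finite field of characteristic $p$ with $q=p^m$ elements, and $f(x)=\sum_{d\in D}\alpha_d x^d\in k[x]$. Let $a_d$ be the Teichmüller lift of $\alpha_d$ to $\mathbb Z_p[\zeta_{q-1}]\subset\mathbb C_p$, put $A=(a_d)_{d\in D}$, and fix $\pi\in\mathbb C_p$ with $\pi^{p-1}=-p$. Set $\theta(X)=\exp(\pi X-\pi X^p)$, $F_1(X)=\prod_{d\in D}\theta(a_dX^d)=\sum_{n\ge0}f_nX^n$ ($f_n=0$ for $n<0$) and $\psi_p(\sum b_nX^n)=\sum b_{pn}X^n$. Let $A_1=(f_{pi-j})_{i,j\ge1}$ be the matrix of $\alpha_1=\psi_p\circ F_1$ in the basis $X,X^2,\dots$, and write $\det(I-TA_1)=1+\sum_{n\ge1}\ell^{(1)}_nT^n$ for its Fredholm determinant (the coefficientwise limit of the polynomials $\det(I-TA_{1,S})$, where $A_{1,S}=(f_{pi-j})_{i,j\in S}$ and $S$ runs through the finite subsets of $\mathbb N_+$ ordered by inclusion). **Modular equations.** For an integer $u\ge 0$ with base $p$ digits $u_0,\dots,u_t$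 put $s_p(u)=\sum_i u_i$ and $u!!=\prod_{i=0}^{t}u_i!$. For $n\ge1$ let $E_{D,p}(n)$ be the set of tuples $U=(u_d)_{d\in D}\in\{0,\dots,p^n-1\}^D$ with $\sum_D d\,u_d\equiv0 \pmod{p^n-1}$ and $\sum_D d\,u_d>0$. For such $U$ put $\ell(U)=n$, $s_p(U)=\sum_D s_p(u_d)$ and $\varphi_n(U)=\frac1{p^n-1}\sum_D d\,u_d$. Let $\delta=\delta_{D,p}=\frac1{p-1}\min_{n\ge1}\frac1n\min_{U\in E_{D,p}(n)}s_p(U)$, and call $U\in E_{D,p}(n)$ minimal if $\frac{s_p(U)}{(p-1)n}=\delta$. Let $\delta_n$ be the map of $\{0,\dots,p^n-1\}$ to itself sending $u\le p^n-2$ to the residue of $pu$ modulo $p^n-1$ and fixing $p^n-1$, applied to tuples coordinatewise. Put $\varphi_U(i)=\varphi_n(\delta_n^i(U))$ for $0\le i\le n-1$ and $\Phi(U)=\{\varphi_U(0),\dots,\varphi_U(n-1)\}$; $U$ is irreducible if $\varphi_U$ is injective. Let $MI_{D,p}$ be the (finite) set of pairs $(n,U)$ with $U\in E_{D,p}(n)$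 minimal and irreducible, $\Sigma=\bigcup_{(n,U)\in MI_{D,p}}\Phi(U)$, $N=\#\Sigma$, and let $MI_{D,p}^*$ be the set of those $(n,U)\in MI_{D,p}$ with $\varphi_U(0)=\min\Phi(U)$ (one representative for each orbit of the shifts $\delta_n$). Let $\mathcal A_{D,p}$ be the set of subsets $\mathcal U=\{U_1,\dots,U_r\}\subset MI_{D,p}^*$ such that $\Sigma=\coprod_{t=1}^r\Phi(U_t)$, put $|\mathcal U|=\sum_t(\ell(U_t)-1)$, and $$\mathcal H^1_{D,p}(A)=\sum_{\mathcal U\in\mathcal A_{D,p}}(-1)^{|\mathcal U|}\prod_{U\in\mathcal U}\frac{A^U}{U!!},\qquad A^U=\prod_{d\in D}a_d^{\,s_p(u_d)},\quad U!!=\prod_{d\in D}u_d!!.$$ **Proposition.** The Fredholm determinant $\det(I-TA_1)$ exists, and $$\ell^{(1)}_N\equiv(-1)^N\,\mathcal H^1_{D,p}(A)\,\pi^{N(p-1)\delta}\pmod{\pi^{N(p-1)\delta+1}},$$ a congruence in the ring of integers of $\mathbb C_p$. (If $N(p-1)\delta$ is not an integer, then $\mathcal A_{D,p}=\emptyset$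 and $\mathcal H^1_{D,p}=0$, and the exponent $N(p-1)\delta$ is to be replaced by its integral part in both places: the congruence then says $\ell_N^{(1)}\equiv0\bmod\pi^{\lfloor N(p-1)\delta\rfloor+1}$.) -/

import Mathlib

/-! ### Digits -/

namespace DworkHasse

/-- The `p`-weight `s_p(u)`: the sum of the base `p` digits of `u`. -/
def weight (p u : ℕ) : ℕ := (Nat.digits p u).sum

/-- `u!!`: the product of the factorials of all the base `p` digits of `u`. -/
def digitFactorial (p u : ℕ) : ℕ := ((Nat.digits p u).map Nat.factorial).prod

/-! ### Modular equations -/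

/-- `∑_{d ∈ D} d u_d`. -/
def dot (D : Finset ℕ) (U : D → ℕ) : ℕ := ∑ d : D, (d : ℕ) * U d

/-- `E_{D,p}(n)`: the tuples in `{0, …, p ^ n - 1} ^ D` with `∑ d u_d` positive and divisible by
`p ^ n - 1` (for `n = 0` this set is empty). -/
def E (D : Finset ℕ) (p n : ℕ) : Set (D → ℕ) :=
  {U | (∀ d, U d ≤ p ^ n - 1) ∧ p ^ n - 1 ∣ dot D U ∧ 0 < dot D U}

/-- The `p`-weight of a tuple. -/
def tupleWeight (D : Finset ℕ) (p : ℕ) (U : D → ℕ) : ℕ := ∑ d : D, weight p (U d)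

/-- `s_{D,p}(n)`, the least `p`-weight of an element of `E_{D,p}(n)`. -/
noncomputable def minWeight (D : Finset ℕ) (p n : ℕ) : ℕ := sInf (tupleWeight D p '' E D p n)

/-- The `p`-density `δ_{D,p} = (p - 1)⁻¹ min_{n ≥ 1} s_{D,p}(n) / n`. -/
noncomputable def density (D : Finset ℕ) (p : ℕ) : ℝ :=
  (⨅ n : ℕ+, (minWeight D p n : ℝ) / (n : ℝ)) / ((p : ℝ) - 1)

/-- The density `s_p(U) / ((p - 1) n)` of an element of `E_{D,p}(n)`. -/
noncomputable def tupleDensity (D : Finset ℕ) (p n : ℕ) (U : D → ℕ) : ℝ :=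
  (tupleWeight D p U : ℝ) / (((p : ℝ) - 1) * (n : ℝ))

/-- The shift `δ_n` of `{0, …, p ^ n - 1}`. -/
def shift (p n k : ℕ) : ℕ := if k = p ^ n - 1 then k else (p * k) % (p ^ n - 1)

/-- The shift of a tuple, coordinate by coordinate. -/
def tupleShift (D : Finset ℕ) (p n : ℕ) (U : D → ℕ) : D → ℕ := fun d => shift p n (U d)

/-- `φ_n(U) = (∑ d u_d) / (p ^ n - 1)`; the division is exact on `E_{D,p}(n)`. -/
def phi (D : Finset ℕ) (p n : ℕ) (U : D → ℕ) : ℕ := dot D U / (p ^ n - 1)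

/-- `φ_U(k) = φ_n(δ_n ^ k (U))`. -/
def phiSeq (D : Finset ℕ) (p n : ℕ) (U : D → ℕ) (k : ℕ) : ℕ :=
  phi D p n ((tupleShift D p n)^[k] U)

/-- The support `Φ(U) = {φ_U(0), …, φ_U(n - 1)}`. -/
def support (D : Finset ℕ) (p n : ℕ) (U : D → ℕ) : Finset ℕ :=
  (Finset.range n).image (phiSeq D p n U)

/-- `MI_{D,p}(n)`: the elements of `E_{D,p}(n)` that are minimal and irreducible. -/
def MI (D : Finset ℕ) (p n : ℕ) : Set (D → ℕ) :=
  {U | U ∈ E D p n ∧ tupleDensity D p n U = density D p ∧ (support D p n U).card = n}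

/-- The disjoint union `MI_{D,p}` of the `MI_{D,p}(n)`, as a set of pairs `(n, U)`. -/
def MIAll (D : Finset ℕ) (p : ℕ) : Set (ℕ × (D → ℕ)) := {x | x.2 ∈ MI D p x.1}

/-- `Σ_{D,p}`, the union of the supports of the minimal irreducible elements. -/
def sigmaSet (D : Finset ℕ) (p : ℕ) : Set ℕ :=
  ⋃ x ∈ MIAll D p, (support D p x.1 x.2 : Set ℕ)

/-- `N_{D,p}`, the cardinality of `Σ_{D,p}` (which is a finite set, see `sigmaSet_finite`). -/
noncomputable def sigmaCard (D : Finset ℕ) (p : ℕ) : ℕ := (sigmaSet D p).ncard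

/-- `MI*_{D,p}`, the set of orbits of the shift on `MI_{D,p}`; each orbit is represented by its
unique element `U` with `φ_U(0) = min Φ(U)`. -/
def MIStar (D : Finset ℕ) (p : ℕ) : Set (ℕ × (D → ℕ)) :=
  {x ∈ MIAll D p | ∀ v ∈ support D p x.1 x.2, phiSeq D p x.1 x.2 0 ≤ v}

/-- `𝒜_{D,p}`: the finite sets `{U_1, …, U_k} ⊆ MI*_{D,p}` whose supports are pairwise disjoint
and have union `Σ_{D,p}`. -/
def partitions (D : Finset ℕ) (p : ℕ) : Set (Finset (ℕ × (D → ℕ))) :=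
  {𝒰 | (𝒰 : Set (ℕ × (D → ℕ))) ⊆ MIStar D p ∧
    (𝒰 : Set (ℕ × (D → ℕ))).PairwiseDisjoint (fun x => support D p x.1 x.2) ∧
    (⋃ x ∈ 𝒰, (support D p x.1 x.2 : Set ℕ)) = sigmaSet D p}

/-- The term `A^U / U!!`. Here `A^U` is the product, over `d ∈ D` and over the base `p` digits `u`
of `u_d`, of `a_d ^ u`, that is `∏_d a_d ^ s_p(u_d)`, and `U!! = ∏_d u_d!!`. -/
noncomputable def hasseTerm (D : Finset ℕ) (p : ℕ) (U : D → ℕ) : MvPolynomial D ℚ :=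
  MvPolynomial.C (∏ d : D, (digitFactorial p (U d) : ℚ))⁻¹ *
    ∏ d : D, MvPolynomial.X d ^ weight p (U d)

/-- The Hasse polynomial `∑_{𝒰 ∈ 𝒜_{D,p}} (-1) ^ |𝒰| ∏_{U ∈ 𝒰} A^U / U!!`, with
`|𝒰| = ∑_{U ∈ 𝒰} (ℓ(U) - 1)`. The sum is finite, see `partitions_finite`; the coefficients are
rational numbers whose denominators are prime to `p`. -/
noncomputable def hassePoly (D : Finset ℕ) (p : ℕ) : MvPolynomial D ℚ :=
  ∑ᶠ 𝒰 ∈ partitions D p,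
    (-1) ^ (∑ x ∈ 𝒰, (x.1 - 1)) * ∏ x ∈ 𝒰, hasseTerm D p x.2

/-! ### Finiteness of the sets above -/

theorem phi_le (D : Finset ℕ) {p n : ℕ} {U : D → ℕ} (hU : ∀ d, U d ≤ p ^ n - 1) :
    phi D p n U ≤ ∑ d : D, (d : ℕ) := by
  unfold phi
  rcases Nat.eq_zero_or_pos (p ^ n - 1) with h | h
  · simp [h]
  · apply Nat.div_le_of_le_mul
    unfold dot
    rw [Finset.mul_sum]
    refine Finset.sum_le_sum fun d _ => ?_
    rw [mul_comm]
    exact Nat.mul_le_mul_right _ (hU d)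

theorem tupleShift_iterate_le (D : Finset ℕ) {p n : ℕ} {U : D → ℕ} (hU : ∀ d, U d ≤ p ^ n - 1)
    (k : ℕ) : ∀ d, (tupleShift D p n)^[k] U d ≤ p ^ n - 1 := by
  induction k with
  | zero => simpa using hU
  | succ k ih =>
    intro d
    rw [Function.iterate_succ_apply']
    have := ih d
    simp only [tupleShift, shift]
    split_ifs with h
    · exact this
    · exact (Nat.mod_lt _ (by omega)).le

theorem support_le (D : Finset ℕ) {p n : ℕ} {U : D → ℕ} (hU : U ∈ E D p n) {v : ℕ}
    (hv : v ∈ support D p n U) : v ≤ ∑ d : D, (d : ℕ) := by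
  obtain ⟨k, -, rfl⟩ := Finset.mem_image.1 hv
  exact phi_le D (tupleShift_iterate_le D hU.1 k)

theorem sigmaSet_finite (D : Finset ℕ) (p : ℕ) : (sigmaSet D p).Finite := by
  refine (Set.finite_Iic (∑ d : D, (d : ℕ))).subset fun v hv => ?_
  simp only [sigmaSet, Set.mem_iUnion] at hv
  obtain ⟨x, hx, hv⟩ := hv
  exact support_le D hx.1 hv

theorem MIAll_finite (D : Finset ℕ) (p : ℕ) : (MIAll D p).Finite := by
  have key : ∀ n, (MI D p n).Finite := fun n =>
    (Set.Finite.pi' (fun _ : D => Set.finite_Iic (p ^ n - 1))).subset fun U hU d => hU.1.1 d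
  refine (((Set.finite_Iic ((∑ d : D, (d : ℕ)) + 1)).biUnion
    fun n _ => (key n).image (Prod.mk n))).subset ?_
  rintro ⟨n, U⟩ hx
  refine Set.mem_biUnion (x := n) ?_ ⟨U, hx, rfl⟩
  have hs : support D p n U ⊆ Finset.range ((∑ d : D, (d : ℕ)) + 1) := fun v hv =>
    Finset.mem_range.2 (Nat.lt_succ_of_le (support_le D hx.1 hv))
  have := Finset.card_le_card hs
  rw [hx.2.2, Finset.card_range] at this
  exact this

theorem partitions_finite (D : Finset ℕ) (p : ℕ) : (partitions D p).Finite :=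
  ((MIAll_finite D p).finite_subsets.preimage Finset.coe_injective.injOn).subset
    fun _ h => h.1.trans fun _ hx => hx.1

/-! ### Dwork's operator -/

open PowerSeries in
/-- Dwork's splitting function `θ(X) = exp(π X - π X ^ p)`. -/
noncomputable def theta {K : Type*} [Field K] [CharZero K] (p : ℕ) (ϖ : K) : PowerSeries K :=
  (PowerSeries.exp K).subst (C ϖ * X - C ϖ * X ^ p)

open PowerSeries in
/-- `F_1(X) = ∏_{d ∈ D} θ(a_d X ^ d)`. -/
noncomputable def F₁ {K : Type*} [Field K] [CharZero K] (p : ℕ) (ϖ : K) (D : Finset ℕ)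
    (a : D → K) : PowerSeries K :=
  ∏ d : D, (theta p ϖ).subst (C (a d) * X ^ (d : ℕ))

/-- `ψ_p (∑ b_n X ^ n) = ∑ b_{pn} X ^ n`. -/
noncomputable def psi {K : Type*} [Field K] (p : ℕ) (h : PowerSeries K) : PowerSeries K :=
  PowerSeries.mk fun n => PowerSeries.coeff (p * n) h

/-- Dwork's operator `α_1 = ψ_p ∘ F_1`. -/
noncomputable def alpha₁ {K : Type*} [Field K] [CharZero K] (p : ℕ) (ϖ : K) (D : Finset ℕ)
    (a : D → K) (h : PowerSeries K) : PowerSeries K :=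
  psi p (F₁ p ϖ D a * h)

/-- The matrix `A_1` of `α_1` in the basis `X, X ^ 2, …`: the column with index `j` holds the
coefficients of `α_1 (X ^ j)`. -/
noncomputable def A₁ {K : Type*} [Field K] [CharZero K] (p : ℕ) (ϖ : K) (D : Finset ℕ)
    (a : D → K) : Matrix ℕ+ ℕ+ K :=
  fun i j => PowerSeries.coeff (i : ℕ) (alpha₁ p ϖ D a (PowerSeries.X ^ (j : ℕ)))

/-- The entries of `A_1` are `f_{pi - j}`, where `F_1 = ∑ f_n X ^ n` and `f_n = 0` for `n < 0`. -/
theorem A₁_apply {K : Type*} [Field K] [CharZero K] (p : ℕ) (ϖ : K) (D : Finset ℕ)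
    (a : D → K) (i j : ℕ+) :
    A₁ p ϖ D a i j =
      if (j : ℕ) ≤ p * i then PowerSeries.coeff (p * i - j) (F₁ p ϖ D a) else 0 := by
  simp [A₁, alpha₁, psi, PowerSeries.coeff_mul_X_pow']

/-! ### Fredholm determinants -/

/-- `P = det(I - T A)` for an infinite matrix `A`: the polynomials `det(I - T A_S)` attached to the
finite principal submatrices `A_S` of `A` converge to the power series `P`, coefficient by
coefficient, as the finite set `S` grows. (`Matrix.charpolyRev M` is `det(1 - X M)`.) -/
def IsFredholmDet {ι K : Type*} [DecidableEq ι] [NormedField K] (A : Matrix ι ι K)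
    (P : PowerSeries K) : Prop :=
  ∀ n : ℕ, Filter.Tendsto
    (fun S : Finset ι => (A.submatrix (Subtype.val : S → ι) Subtype.val).charpolyRev.coeff n)
    Filter.atTop (nhds (PowerSeries.coeff n P))

/-- There is at most one such power series. -/
theorem IsFredholmDet.unique {ι K : Type*} [DecidableEq ι] [NormedField K] {A : Matrix ι ι K}
    {P Q : PowerSeries K} (hP : IsFredholmDet A P) (hQ : IsFredholmDet A Q) : P = Q :=
  PowerSeries.ext fun n => tendsto_nhds_unique (hP n) (hQ n)

/-- `x ≡ y mod ϖ ^ r` in the ring of integers: `x - y` is `ϖ ^ r` times an element of norm at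
most one. -/
def CongrMod {K : Type*} [NormedField K] (ϖ : K) (r : ℕ) (x y : K) : Prop :=
  ∃ c : K, ‖c‖ ≤ 1 ∧ x - y = ϖ ^ r * c

/-- The coefficients `(a_d)_{d ∈ D}` of `f̃`: the Teichmüller lifts of the coefficients of `f`,
seen in `K` through an embedding `j` of the ring `W(k)` of Witt vectors of `k`. -/
noncomputable def liftCoeff {k K : Type*} [Field k] [Field K] (p : ℕ) [Fact p.Prime]
    (j : WittVector p k →+* K) (D : Finset ℕ) (f : Polynomial k) : D → K :=
  fun d => j (WittVector.teichmuller p (f.coeff d))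

end DworkHasse

namespace DworkHasse

/-! ### Digit sums -/

theorem weight_mul_add {p : ℕ} (hp : 1 < p) (v : ℕ) {t : ℕ} (ht : t < p) :
    weight p (p * v + t) = weight p v + t := by
  rcases Nat.eq_zero_or_pos (p * v + t) with h | h
  · have h1 : t = 0 := by omega
    have h2 : v = 0 := by
      rcases Nat.mul_eq_zero.1 (show p * v = 0 by omega) with h | h <;> omega
    simp [h1, h2]
  · rw [weight, weight, Nat.digits_def' hp h, Nat.mul_add_mod, Nat.mod_eq_of_lt ht,
      Nat.mul_add_div (by omega), Nat.div_eq_of_lt ht]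
    simp [add_comm]

theorem digitFactorial_mul_add {p : ℕ} (hp : 1 < p) (v : ℕ) {t : ℕ} (ht : t < p) :
    digitFactorial p (p * v + t) = digitFactorial p v * t.factorial := by
  rcases Nat.eq_zero_or_pos (p * v + t) with h | h
  · have h1 : t = 0 := by omega
    have h2 : v = 0 := by
      rcases Nat.mul_eq_zero.1 (show p * v = 0 by omega) with h | h <;> omega
    simp [h1, h2]
  · rw [digitFactorial, digitFactorial, Nat.digits_def' hp h, Nat.mul_add_mod,
      Nat.mod_eq_of_lt ht, Nat.mul_add_div (by omega), Nat.div_eq_of_lt ht]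
    simp [mul_comm]

theorem weight_zero (p : ℕ) : weight p 0 = 0 := by simp [weight]

theorem weight_of_lt {p t : ℕ} (hp : 1 < p) (ht : t < p) : weight p t = t := by
  simpa [weight_zero] using weight_mul_add hp 0 ht

theorem weight_mul {p : ℕ} (hp : 1 < p) (v : ℕ) : weight p (p * v) = weight p v := by
  simpa using weight_mul_add hp v (show 0 < p by omega)

theorem weight_add_le {p : ℕ} (hp : 1 < p) (a b : ℕ) :
    weight p (a + b) ≤ weight p a + weight p b := by
  induction a using Nat.strong_induction_on generalizing b with
  | _ a ih =>
    have h1 : ∀ v, weight p (v + 1) ≤ weight p v + 1 := by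
      intro v
      induction v using Nat.strong_induction_on with
      | _ v ihv =>
        have hv := Nat.div_add_mod v p
        have hm := Nat.mod_lt v (show 0 < p by omega)
        by_cases hc : v % p + 1 < p
        · have e1 := weight_mul_add hp (v / p) hc
          have e2 := weight_mul_add hp (v / p) hm
          rw [← add_assoc, hv] at e1
          rw [hv] at e2
          omega
        · have e2 := weight_mul_add hp (v / p) hm
          rw [hv] at e2
          have e1 : v + 1 = p * (v / p + 1) := by rw [mul_add]; omega
          rw [e1, weight_mul hp]
          have hv0 : 0 < v := by rcases v with _ | v <;> simp at hc <;> omega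
          have hlt : v / p < v := Nat.div_lt_self hv0 hp
          have := ihv (v / p) hlt
          omega
    rcases Nat.eq_zero_or_pos a with rfl | ha
    · simp [weight_zero]
    · have ea := Nat.div_add_mod a p
      have eb := Nat.div_add_mod b p
      have hma := Nat.mod_lt a (show 0 < p by omega)
      have hmb := Nat.mod_lt b (show 0 < p by omega)
      have wa := weight_mul_add hp (a / p) hma
      have wb := weight_mul_add hp (b / p) hmb
      rw [ea] at wa
      rw [eb] at wb
      have hab := ih (a / p) (Nat.div_lt_self ha hp) (b / p)
      by_cases hc : a % p + b % p < p
      · have e := weight_mul_add hp (a / p + b / p) hc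
        have : p * (a / p + b / p) + (a % p + b % p) = a + b := by rw [mul_add]; omega
        rw [this] at e
        omega
      · have e := weight_mul_add hp (a / p + b / p + 1) (show a % p + b % p - p < p by omega)
        have : p * (a / p + b / p + 1) + (a % p + b % p - p) = a + b := by
          rw [mul_add, mul_add]; omega
        rw [this] at e
        have := h1 (a / p + b / p)
        omega

theorem weight_add_pow_mul {p : ℕ} (hp : 1 < p) (n : ℕ) {a : ℕ} (ha : a < p ^ n) (b : ℕ) :
    weight p (a + p ^ n * b) = weight p a + weight p b := by
  induction n generalizing a with
  | zero => simp_all [weight_zero]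
  | succ n ih =>
    have hm := Nat.mod_lt a (show 0 < p by omega)
    have ea := Nat.div_add_mod a p
    have hd : a / p < p ^ n := Nat.div_lt_of_lt_mul (by rwa [pow_succ'] at ha)
    have e1 := weight_mul_add hp (a / p + p ^ n * b) hm
    have e2 := weight_mul_add hp (a / p) hm
    rw [ih hd] at e1
    have : p * (a / p + p ^ n * b) + a % p = a + p ^ (n + 1) * b := by
      conv_rhs => rw [← ea]
      ring
    rw [this] at e1
    rw [ea] at e2
    omega

/-- Reduction modulo `p ^ n - 1` to a number with `n` digits does not increase the digit sum. -/
theorem exists_reduce {p n : ℕ} (hp : 1 < p) (hn : 0 < n) (v : ℕ) :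
    ∃ v', v' ≤ p ^ n - 1 ∧ v' ≡ v [MOD p ^ n - 1] ∧ weight p v' ≤ weight p v ∧
      (0 < v → 0 < v') := by
  induction v using Nat.strong_induction_on with
  | _ v ih =>
    have hq : 1 < p ^ n := Nat.one_lt_pow (by omega) hp
    by_cases hv : v < p ^ n
    · exact ⟨v, by omega, rfl, le_rfl, id⟩
    · have ev := Nat.mod_add_div v (p ^ n)
      have hm := Nat.mod_lt v (show 0 < p ^ n by omega)
      have hd : 0 < v / p ^ n := Nat.div_pos (by omega) (by omega)
      have hlt : v % p ^ n + v / p ^ n < v := by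
        have : 2 * (v / p ^ n) ≤ p ^ n * (v / p ^ n) := Nat.mul_le_mul_right _ hq
        omega
      obtain ⟨v', h1, h2, h3, h4⟩ := ih _ hlt
      refine ⟨v', h1, h2.trans ?_, h3.trans ?_, fun _ => h4 (Nat.add_pos_right _ hd)⟩
      · have : v = v % p ^ n + v / p ^ n + (p ^ n - 1) * (v / p ^ n) := by
          obtain ⟨q, hq'⟩ : ∃ q, p ^ n = q + 1 := ⟨p ^ n - 1, by omega⟩
          conv_lhs => rw [← ev]
          rw [hq']
          simp
          ring
        conv_rhs => rw [this]
        exact (Nat.modEq_iff_dvd' (by omega)).2 ⟨v / p ^ n, Nat.add_sub_cancel_left _ _⟩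
      · have := weight_add_pow_mul hp n hm (v / p ^ n)
        rw [ev] at this
        rw [this]
        exact weight_add_le hp _ _

/-! ### Numbers given by a sequence of digits -/

/-- The number `∑_{k < n} w_k p ^ (n - 1 - k)`. -/
def horner (p : ℕ) (w : ℕ → ℕ) : ℕ → ℕ
  | 0 => 0
  | n + 1 => p * horner p w n + w n

theorem horner_succ' (p : ℕ) (w : ℕ → ℕ) (n : ℕ) :
    horner p w (n + 1) = p ^ n * w 0 + horner p (fun k => w (k + 1)) n := by
  induction n with
  | zero => simp [horner]
  | succ n ih =>
    rw [horner, ih, horner]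
    ring

theorem horner_lt {p : ℕ} {w : ℕ → ℕ} (hw : ∀ k, w k < p) (n : ℕ) : horner p w n < p ^ n := by
  induction n with
  | zero => simp [horner]
  | succ n ih =>
    have := hw n
    calc horner p w (n + 1) < p * horner p w n + p := by rw [horner]; omega
      _ = p * (horner p w n + 1) := by ring
      _ ≤ p ^ (n + 1) := by rw [pow_succ']; exact Nat.mul_le_mul_left _ ih

theorem weight_horner_le {p : ℕ} (hp : 1 < p) (w : ℕ → ℕ) (n : ℕ) :
    weight p (horner p w n) ≤ ∑ k ∈ Finset.range n, weight p (w k) := by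
  induction n with
  | zero => simp [horner, weight_zero]
  | succ n ih =>
    rw [Finset.sum_range_succ, horner]
    refine (weight_add_le hp _ _).trans ?_
    rw [weight_mul hp]
    omega

theorem weight_horner {p : ℕ} (hp : 1 < p) {w : ℕ → ℕ} (hw : ∀ k, w k < p) (n : ℕ) :
    weight p (horner p w n) = ∑ k ∈ Finset.range n, w k := by
  induction n with
  | zero => simp [horner, weight_zero]
  | succ n ih => rw [Finset.sum_range_succ, horner, weight_mul_add hp _ (hw n), ih]

theorem digitFactorial_horner {p : ℕ} (hp : 1 < p) {w : ℕ → ℕ} (hw : ∀ k, w k < p) (n : ℕ) :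
    digitFactorial p (horner p w n) = ∏ k ∈ Finset.range n, (w k).factorial := by
  induction n with
  | zero => simp [horner, digitFactorial]
  | succ n ih => rw [Finset.prod_range_succ, horner, digitFactorial_mul_add hp _ (hw n), ih]

theorem horner_digits {p n v : ℕ} (hv : v < p ^ n) :
    horner p (fun k => v / p ^ (n - 1 - k) % p) n = v := by
  have key : ∀ m ≤ n, horner p (fun k => v / p ^ (n - 1 - k) % p) m = v / p ^ (n - m) := by
    intro m
    induction m with
    | zero => intro _; simp [horner, Nat.div_eq_of_lt hv]
    | succ m ih =>
      intro hm
      rw [horner, ih (by omega), show n - m = (n - 1 - m) + 1 by omega,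
        show n - (m + 1) = n - 1 - m by omega, pow_succ, ← Nat.div_div_eq_div_mul]
      exact Nat.div_add_mod _ _
  simpa using key n le_rfl

theorem horner_congr {p n : ℕ} {w w' : ℕ → ℕ} (h : ∀ k < n, w k = w' k) :
    horner p w n = horner p w' n := by
  induction n with
  | zero => rfl
  | succ n ih => rw [horner, horner, ih fun k hk => h k (by omega), h n (by omega)]

theorem eq_of_horner_eq {p : ℕ} {w w' : ℕ → ℕ} (hw : ∀ k, w k < p) (hw' : ∀ k, w' k < p) {n : ℕ}
    (h : horner p w n = horner p w' n) : ∀ k < n, w k = w' k := by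
  induction n with
  | zero => simp
  | succ n ih =>
    rw [horner, horner] at h
    have h1 : w n = w' n := by
      have := congrArg (· % p) h
      simpa [Nat.mul_add_mod, Nat.mod_eq_of_lt, hw, hw'] using this
    have h2 : horner p w n = horner p w' n :=
      Nat.eq_of_mul_eq_mul_left ((Nat.zero_le _).trans_lt (hw 0)) (by omega)
    intro k hk
    rcases Nat.lt_succ_iff_lt_or_eq.1 hk with hk | rfl
    · exact ih h2 k hk
    · exact h1

theorem shift_horner {p : ℕ} (hp : 1 < p) {w : ℕ → ℕ} (hw : ∀ k, w k < p) {n : ℕ} (hn : 0 < n)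
    (hwn : w n = w 0) :
    shift p n (horner p w n) = horner p (fun k => w (k + 1)) n := by
  have hq : 1 < p ^ n := Nat.one_lt_pow (by omega) hp
  have h1 := horner_succ' p w n
  rw [horner, hwn] at h1
  have hlt := horner_lt hw n
  have hlt' := horner_lt (fun k => hw (k + 1)) n
  set v := horner p w n
  set v' := horner p (fun k => w (k + 1)) n
  obtain ⟨q, hq'⟩ : ∃ q, p ^ n = q + 1 := ⟨p ^ n - 1, by omega⟩
  have h0 := hw 0
  have h2 : p * v = q * w 0 + v' := by
    rw [hq'] at h1
    have : (q + 1) * w 0 = q * w 0 + w 0 := by ring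
    omega
  have hpq : Nat.Coprime q p := by
    have : Nat.Coprime q (p ^ n) := by rw [hq']; simp
    exact Nat.Coprime.coprime_dvd_right (dvd_pow_self p (by omega)) this
  have hz : p ^ n - 1 = q := by omega
  rw [shift, hz]
  split_ifs with hv
  · rw [hv] at h2 ⊢
    have h3 : v' = q * (p - w 0) := by
      rw [Nat.mul_sub, mul_comm q p]
      omega
    have h4 : 0 < p - w 0 := by omega
    have h5 : q * 1 ≤ q * (p - w 0) := Nat.mul_le_mul_left _ h4
    omega
  · rw [h2, Nat.mul_add_mod]
    apply Nat.mod_eq_of_lt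
    by_contra hc
    have hv'q : v' = q := by omega
    have hdvd : q ∣ p * v := by
      rw [h2, hv'q]
      exact (dvd_mul_right _ _).add dvd_rfl
    have hdv : q ∣ v := hpq.dvd_of_dvd_mul_left hdvd
    have hv0 : v = 0 := Nat.eq_zero_of_dvd_of_lt hdv (by omega)
    rw [hv0] at h2
    omega

/-! ### Tuples given by a sequence of tuples of digits -/

section Tuple

variable {D : Finset ℕ} {p : ℕ}

/-- The tuple `∑_{k < n} w_k p ^ (n - 1 - k)`. -/
def tupleHorner (D : Finset ℕ) (p : ℕ) (w : ℕ → D → ℕ) (n : ℕ) : D → ℕ :=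
  fun d => horner p (fun k => w k d) n

theorem dot_tupleHorner {w : ℕ → D → ℕ} {c : ℕ → ℕ}
    (hc : ∀ k, dot D (w k) + c (k + 1) = p * c k) (n : ℕ) :
    dot D (tupleHorner D p w n) + c n = p ^ n * c 0 := by
  induction n with
  | zero => simp [tupleHorner, horner, dot]
  | succ n ih =>
    have : dot D (tupleHorner D p w (n + 1)) = p * dot D (tupleHorner D p w n) + dot D (w n) := by
      simp only [dot, tupleHorner, horner, Finset.mul_sum, ← Finset.sum_add_distrib]
      exact Finset.sum_congr rfl fun d _ => by ring
    rw [this, pow_succ', mul_assoc, ← ih, mul_add, ← hc n]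
    ring

theorem dot_tupleHorner_of_periodic {w : ℕ → D → ℕ} {c : ℕ → ℕ}
    (hc : ∀ k, dot D (w k) + c (k + 1) = p * c k) {n : ℕ} (hn : c n = c 0) :
    dot D (tupleHorner D p w n) = (p ^ n - 1) * c 0 := by
  have := dot_tupleHorner hc n
  rw [Nat.sub_mul]
  omega

theorem density_nonneg (D : Finset ℕ) (hp : 1 < p) : 0 ≤ density D p := by
  have hp1 : (1 : ℝ) < p := by exact_mod_cast hp
  exact div_nonneg (Real.iInf_nonneg fun n => by positivity) (by linarith)

theorem mul_density_le (hp : 1 < p) {n : ℕ} (hn : 0 < n) {U : D → ℕ} (hU : U ∈ E D p n) :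
    (n : ℝ) * (((p : ℝ) - 1) * density D p) ≤ tupleWeight D p U := by
  have hp1 : (0 : ℝ) < (p : ℝ) - 1 := by
    have : (1 : ℝ) < p := by exact_mod_cast hp
    linarith
  have h1 : minWeight D p n ≤ tupleWeight D p U := Nat.sInf_le ⟨U, hU, rfl⟩
  have h2 : (⨅ n : ℕ+, (minWeight D p n : ℝ) / (n : ℝ)) ≤ (minWeight D p n : ℝ) / n :=
    ciInf_le (f := fun n : ℕ+ => (minWeight D p n : ℝ) / ((n : ℕ) : ℝ))
      ⟨0, by rintro _ ⟨m, rfl⟩; positivity⟩ ⟨n, hn⟩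
  rw [density, mul_div_cancel₀ _ hp1.ne']
  rw [le_div_iff₀ (by exact_mod_cast hn)] at h2
  calc _ ≤ (minWeight D p n : ℝ) := by rw [mul_comm]; exact h2
    _ ≤ _ := by exact_mod_cast h1

/-- The weights along a closed path are bounded below by the density. -/
theorem mul_density_le_sum (hp : 1 < p) {w : ℕ → D → ℕ} {c : ℕ → ℕ}
    (hc : ∀ k, dot D (w k) + c (k + 1) = p * c k) {n : ℕ} (hn : 0 < n) (hcn : c n = c 0)
    (hc0 : 0 < c 0) :
    (n : ℝ) * (((p : ℝ) - 1) * density D p) ≤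
      (∑ k ∈ Finset.range n, tupleWeight D p (w k) : ℕ) := by
  have hq : 1 < p ^ n := Nat.one_lt_pow (by omega) hp
  have hdot := dot_tupleHorner_of_periodic hc hcn
  choose V h1 h2 h3 h4 using fun d : D => exists_reduce hp hn (tupleHorner D p w n d)
  have hpos : 0 < dot D (tupleHorner D p w n) := by
    rw [hdot]
    exact Nat.mul_pos (by omega) hc0
  have hV : V ∈ E D p n := by
    refine ⟨h1, ?_, ?_⟩
    · have : dot D V ≡ dot D (tupleHorner D p w n) [MOD p ^ n - 1] :=
        Nat.ModEq.sum fun d _ => (h2 d).mul_left _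
      exact (this.dvd_iff dvd_rfl).2 (hdot ▸ dvd_mul_right _ _)
    · rw [dot, Finset.sum_pos_iff] at hpos ⊢
      obtain ⟨d, hd, hpos⟩ := hpos
      exact ⟨d, hd, Nat.mul_pos (Nat.pos_of_mul_pos_right hpos)
        (h4 d (Nat.pos_of_mul_pos_left hpos))⟩
  refine (mul_density_le hp hn hV).trans ?_
  norm_cast
  calc tupleWeight D p V ≤ ∑ d : D, ∑ k ∈ Finset.range n, weight p (w k d) :=
        Finset.sum_le_sum fun d _ => (h3 d).trans (weight_horner_le hp _ n)
    _ = _ := Finset.sum_comm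

theorem tupleWeight_tupleHorner (hp : 1 < p) {w : ℕ → D → ℕ} (hw : ∀ k d, w k d < p) (n : ℕ) :
    tupleWeight D p (tupleHorner D p w n) = ∑ k ∈ Finset.range n, tupleWeight D p (w k) := by
  simp only [tupleWeight]
  rw [Finset.sum_comm]
  refine Finset.sum_congr rfl fun d _ => ?_
  rw [tupleHorner, weight_horner hp (fun k => hw k d)]
  exact Finset.sum_congr rfl fun k _ => (weight_of_lt hp (hw k d)).symm

theorem iterate_tupleShift_tupleHorner (hp : 1 < p) {w : ℕ → D → ℕ} (hw : ∀ k d, w k d < p)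
    {n : ℕ} (hn : 0 < n) (hper : ∀ k, w (k + n) = w k) (m : ℕ) :
    (tupleShift D p n)^[m] (tupleHorner D p w n) = tupleHorner D p (fun k => w (k + m)) n := by
  induction m with
  | zero => rfl
  | succ m ih =>
    rw [Function.iterate_succ_apply', ih]
    funext d
    have := shift_horner hp (w := fun k => w (k + m) d) (fun k => hw _ d) hn
      (by rw [add_comm n m, hper]; simp)
    rw [tupleShift, tupleHorner, this, tupleHorner]
    exact horner_congr fun k _ => by rw [add_right_comm, add_assoc]

theorem phiSeq_tupleHorner (hp : 1 < p) {w : ℕ → D → ℕ} (hw : ∀ k d, w k d < p) {c : ℕ → ℕ}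
    (hc : ∀ k, dot D (w k) + c (k + 1) = p * c k) {n : ℕ} (hn : 0 < n)
    (hper : ∀ k, w (k + n) = w k) (hcper : ∀ k, c (k + n) = c k) (m : ℕ) :
    phiSeq D p n (tupleHorner D p w n) m = c m := by
  have hq : 1 < p ^ n := Nat.one_lt_pow (by omega) hp
  rw [phiSeq, iterate_tupleShift_tupleHorner hp hw hn hper, phi]
  have := dot_tupleHorner_of_periodic (D := D) (n := n) (p := p) (w := fun k => w (k + m))
    (c := fun k => c (k + m)) (fun k => by rw [← hc (k + m), add_right_comm])
    (by simp [add_comm n m, hcper])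
  rw [this, zero_add, Nat.mul_div_cancel_left _ (by omega)]

/-- Every tuple in `E_{D,p}(n)` comes from a periodic sequence of tuples of digits. -/
theorem exists_digits (hp : 1 < p) {n : ℕ} {U : D → ℕ} (hU : U ∈ E D p n) :
    ∃ w : ℕ → D → ℕ, (∀ k d, w k d < p) ∧ (∀ k, w (k + n) = w k) ∧ tupleHorner D p w n = U ∧
      (∀ k, phiSeq D p n U (k + n) = phiSeq D p n U k) ∧ (∀ k, 0 < phiSeq D p n U k) ∧
      ∀ k, dot D (w k) + phiSeq D p n U (k + 1) = p * phiSeq D p n U k := by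
  have hn : 0 < n := by
    rcases Nat.eq_zero_or_pos n with rfl | hn
    · have h0 : ∀ d, U d = 0 := by simpa using hU.1
      have := hU.2.2
      simp [dot, h0] at this
    · exact hn
  have hq : 1 < p ^ n := Nat.one_lt_pow (by omega) hp
  let w : ℕ → D → ℕ := fun k d => U d / p ^ (n - 1 - k % n) % p
  have hw : ∀ k d, w k d < p := fun k d => Nat.mod_lt _ (by omega)
  have hper : ∀ k, w (k + n) = w k := fun k => by simp [w]
  have hU' : tupleHorner D p w n = U := by
    funext d
    have hd := hU.1 d
    rw [tupleHorner]
    conv_rhs => rw [← horner_digits (p := p) (n := n) (v := U d) (by omega)]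
    exact horner_congr fun k hk => by simp [w, Nat.mod_eq_of_lt hk]
  have hiter := iterate_tupleShift_tupleHorner hp hw hn hper
  rw [hU'] at hiter
  have hstep : ∀ m, p * dot D ((tupleShift D p n)^[m] U) =
      (p ^ n - 1) * dot D (w m) + dot D ((tupleShift D p n)^[m + 1] U) := by
    intro m
    rw [hiter, hiter]
    simp only [dot, tupleHorner, Finset.mul_sum, ← Finset.sum_add_distrib]
    refine Finset.sum_congr rfl fun d _ => ?_
    have h1 := horner_succ' p (fun k => w (k + m) d) n
    rw [horner, add_comm n m, hper, zero_add] at h1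
    simp only [add_right_comm _ 1 m] at h1
    obtain ⟨q, hq'⟩ : ∃ q, p ^ n = q + 1 := ⟨p ^ n - 1, by omega⟩
    have h2 : p * horner p (fun k => w (k + m) d) n =
        q * w m d + horner p (fun k => w (k + m + 1) d) n := by
      rw [hq'] at h1
      have : (q + 1) * w m d = q * w m d + w m d := by ring
      omega
    rw [hq', Nat.add_sub_cancel, mul_left_comm, h2]
    simp only [← add_assoc]
    ring
  have hdvd : ∀ m, p ^ n - 1 ∣ dot D ((tupleShift D p n)^[m] U) := by
    intro m
    induction m with
    | zero => exact hU.2.1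
    | succ m ih =>
      exact (Nat.dvd_add_right (dvd_mul_right _ (dot D (w m)))).1 (hstep m ▸ ih.mul_left p)
  have hphi : ∀ m, dot D ((tupleShift D p n)^[m] U) = (p ^ n - 1) * phiSeq D p n U m :=
    fun m => (Nat.mul_div_cancel' (hdvd m)).symm
  have hphiper : ∀ k, phiSeq D p n U (k + n) = phiSeq D p n U k := by
    intro k
    rw [phiSeq, phiSeq, hiter, hiter]
    congr 2
    funext j
    rw [← add_assoc, hper]
  have hrec : ∀ k, dot D (w k) + phiSeq D p n U (k + 1) = p * phiSeq D p n U k := by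
    intro k
    have := hstep k
    rw [hphi, hphi, mul_left_comm, ← mul_add] at this
    exact (Nat.eq_of_mul_eq_mul_left (by omega) this).symm
  refine ⟨w, hw, hper, hU', hphiper, fun k => ?_, hrec⟩
  have h0 : 0 < phiSeq D p n U 0 := by
    refine Nat.pos_of_mul_pos_left (a := p ^ n - 1) ?_
    rw [← hphi]
    exact hU.2.2
  by_contra hk
  have hzero : ∀ m, phiSeq D p n U (k + m) = 0 := by
    intro m
    induction m with
    | zero => exact Nat.eq_zero_of_not_pos hk
    | succ m ih =>
      have := hrec (k + m)
      rw [ih, mul_zero] at this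
      exact (Nat.add_eq_zero_iff.1 this).2
  have hper' := (show Function.Periodic (phiSeq D p n U) n from hphiper).nat_mul k 0
  rw [zero_add] at hper'
  have hkn : k ≤ k * n := Nat.le_mul_of_pos_right k hn
  have := hzero (k * n - k)
  rw [Nat.add_sub_cancel' hkn] at this
  have : phiSeq D p n U 0 = 0 := by rw [← hper']; simpa using this
  omega

end Tuple

end DworkHasse

namespace DworkHasse

open Finset

/-! ### Products of consecutive units -/

/-- If `h ≡ 1 mod p` is suitably continuous, then the products of `p ^ m` consecutive values of `h`
are `1` modulo `p ^ m`. -/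
theorem prod_range_pow_modEq_one {p : ℕ} {h : ℕ → ℤ} (h1 : ∀ a, h a ≡ 1 [ZMOD p])
    (h2 : ∀ m a, h (a + p ^ m) ≡ h a [ZMOD (p : ℤ) ^ (m + 1)]) (m c : ℕ) :
    ∏ k ∈ range (p ^ m), h (c + k) ≡ 1 [ZMOD (p : ℤ) ^ m] := by
  induction m generalizing c with
  | zero => simp [Int.modEq_one]
  | succ m ih =>
    have hshift : ∀ s c, h (c + s * p ^ m) ≡ h c [ZMOD (p : ℤ) ^ (m + 1)] := by
      intro s
      induction s with
      | zero => intro c; simp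
      | succ s ihs =>
        intro c
        rw [show c + (s + 1) * p ^ m = (c + s * p ^ m) + p ^ m by ring]
        exact (h2 m _).trans (ihs c)
    have hpow : ∀ s, ∏ k ∈ range (s * p ^ m), h (c + k) ≡
        (∏ k ∈ range (p ^ m), h (c + k)) ^ s [ZMOD (p : ℤ) ^ (m + 1)] := by
      intro s
      induction s with
      | zero => simp
      | succ s ihs =>
        rw [add_mul, one_mul, prod_range_add, pow_succ (∏ k ∈ range (p ^ m), h (c + k))]
        refine ihs.mul (Int.ModEq.prod fun k _ => ?_)
        rw [← add_assoc, add_right_comm]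
        exact hshift s (c + k)
    rw [pow_succ' p m]
    refine (hpow p).trans ?_
    rcases Nat.eq_zero_or_pos m with rfl | hm
    · simpa using (h1 c).pow p
    · have hP := ih c
      set P := ∏ k ∈ range (p ^ m), h (c + k)
      have hP1 : P ≡ 1 [ZMOD p] := hP.of_dvd (dvd_pow_self _ hm.ne')
      have hg : (p : ℤ) ∣ ∑ i ∈ range p, P ^ i := by
        have : ∑ i ∈ range p, P ^ i ≡ ∑ i ∈ range p, 1 ^ i [ZMOD p] :=
          Int.ModEq.sum fun i _ => hP1.pow i
        exact this.dvd_iff.2 (by simp)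
      have hd : (p : ℤ) ^ m ∣ P - 1 := hP.symm.dvd
      refine (Int.modEq_iff_dvd.2 ?_).symm
      rw [← geom_sum_mul, pow_succ']
      exact mul_dvd_mul hg hd

/-- The product, up to sign, of the prime-to-`p` integers among
`p a + t + 1, …, p (a + 1) + t`. -/
def unitBlock (p t a : ℕ) : ℤ :=
  -((∏ i ∈ Ico (t + 1) p, ((p : ℤ) * a + i)) * ∏ i ∈ Ico 1 (t + 1), ((p : ℤ) * (a + 1) + i))

theorem unitBlock_modEq_one {p : ℕ} [Fact p.Prime] {t : ℕ} (ht : t < p) (a : ℕ) :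
    unitBlock p t a ≡ 1 [ZMOD p] := by
  rw [← ZMod.intCast_eq_intCast_iff]
  simp only [unitBlock, Int.cast_neg, Int.cast_mul, Int.cast_prod, Int.cast_add, Int.cast_natCast,
    CharP.cast_eq_zero, zero_mul, zero_add, Int.cast_one]
  rw [mul_comm, prod_Ico_consecutive _ (by omega) (by omega), ZMod.prod_Ico_one_prime, neg_neg]

theorem unitBlock_add_pow (p t m a : ℕ) :
    unitBlock p t (a + p ^ m) ≡ unitBlock p t a [ZMOD (p : ℤ) ^ (m + 1)] := by
  refine Int.ModEq.neg (Int.ModEq.mul (Int.ModEq.prod fun i _ => ?_) (Int.ModEq.prod fun i _ => ?_))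
  all_goals
    refine Int.ModEq.add_right _ (Int.modEq_iff_dvd.2 ⟨-1, ?_⟩)
    push_cast
    ring

theorem factorial_add_eq_mul_prod (N : ℕ) {a b : ℕ} (hab : a ≤ b) :
    (N + b).factorial = (N + a).factorial * ∏ i ∈ Ico (a + 1) (b + 1), (N + i) := by
  induction b, hab using Nat.le_induction with
  | base => simp
  | succ b hab ih =>
    rw [← add_assoc, Nat.factorial_succ, ih, prod_Ico_succ_top (show a + 1 ≤ b + 1 by omega)]
    ring

theorem factorial_block {p t : ℕ} (ht : t < p) (a : ℕ) :
    ((p * (a + 1) + t).factorial : ℤ) =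
      -((p * a + t).factorial * (p * (a + 1)) * unitBlock p t a) := by
  have h1 := factorial_add_eq_mul_prod (p * a) (show t ≤ p - 1 by omega)
  have h2 := factorial_add_eq_mul_prod (p * (a + 1)) (Nat.zero_le t)
  have h3 : (p * (a + 1)).factorial = p * (a + 1) * (p * a + (p - 1)).factorial := by
    have : p * (a + 1) = p * a + (p - 1) + 1 := by rw [mul_add]; omega
    rw [this, Nat.factorial_succ]
  rw [show p - 1 + 1 = p by omega] at h1
  rw [add_zero, h3, h1, zero_add] at h2
  rw [h2, unitBlock]
  push_cast
  ring

/-! ### Iterated differences -/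

section Ultrametric

variable {K : Type*} [NormedField K]

theorem norm_sum_le_of_forall_norm_le [IsUltrametricDist K]
    {ι : Type*} {s : Finset ι} {f : ι → K} {C : ℝ} (hC : 0 ≤ C)
    (h : ∀ i ∈ s, ‖f i‖ ≤ C) : ‖∑ i ∈ s, f i‖ ≤ C :=
  IsUltrametricDist.norm_sum_le_of_forall_le_of_nonneg hC h

theorem norm_add_le_of_le [IsUltrametricDist K]
    {x y : K} {C : ℝ} (hx : ‖x‖ ≤ C) (hy : ‖y‖ ≤ C) : ‖x + y‖ ≤ C :=
  (IsUltrametricDist.norm_add_le_max x y).trans (max_le hx hy)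

theorem norm_sub_le_of_le [IsUltrametricDist K]
    {x y : K} {C : ℝ} (hx : ‖x‖ ≤ C) (hy : ‖y‖ ≤ C) : ‖x - y‖ ≤ C := by
  rw [sub_eq_add_neg]
  exact norm_add_le_of_le hx (by rwa [norm_neg])

theorem norm_intCast_le_pow_of_dvd [IsUltrametricDist K] {p m : ℕ} {z : ℤ} (h : (p : ℤ) ^ m ∣ z) :
    ‖(z : K)‖ ≤ ‖(p : K)‖ ^ m := by
  obtain ⟨y, rfl⟩ := h
  push_cast
  rw [norm_mul, norm_pow]
  exact mul_le_of_le_one_right (by positivity) (IsUltrametricDist.norm_intCast_le_one K y)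

theorem norm_intCast_eq_one_of_modEq [IsUltrametricDist K]
    {p : ℕ} (hp : ‖(p : K)‖ < 1) {z : ℤ} (h : z ≡ 1 [ZMOD p]) :
    ‖(z : K)‖ = 1 := by
  refine le_antisymm (IsUltrametricDist.norm_intCast_le_one K z) ?_
  by_contra hz
  have h1 : ‖((1 - z : ℤ) : K)‖ ≤ ‖(p : K)‖ ^ 1 :=
    norm_intCast_le_pow_of_dvd (by simpa using h.dvd)
  have h2 : ‖(1 : K)‖ ≤ max ‖((1 - z : ℤ) : K)‖ ‖(z : K)‖ := by
    have := IsUltrametricDist.norm_add_le_max ((1 - z : ℤ) : K) (z : K)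
    rwa [← Int.cast_add, sub_add_cancel, Int.cast_one] at this
  rw [norm_one] at h2
  rcases le_max_iff.1 h2 with h | h <;> linarith

theorem norm_fwdDiff_iter_le [IsUltrametricDist K]
    {f : ℕ → K} {C : ℝ} (hf : ∀ a, ‖f a‖ ≤ C) (k a : ℕ) :
    ‖(fwdDiff 1)^[k] f a‖ ≤ C := by
  induction k generalizing a with
  | zero => exact hf a
  | succ k ih =>
    rw [Function.iterate_succ_apply', fwdDiff]
    exact norm_sub_le_of_le (ih _) (ih _)

theorem fwdDiff_iter_sub (f g : ℕ → K) (k a : ℕ) :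
    (fwdDiff 1)^[k] (fun b => f b - g b) a = (fwdDiff 1)^[k] f a - (fwdDiff 1)^[k] g a := by
  simp only [fwdDiff_iter_eq_sum_shift, smul_sub, sum_sub_distrib]

/-- The iterated differences of a `p`-adically uniformly continuous function tend to zero. -/
theorem exists_forall_norm_fwdDiff_iter_le [IsUltrametricDist K] {p : ℕ} [Fact p.Prime] {f : ℕ → K}
    (hf : ∀ a, ‖f a‖ ≤ 1) (hc : ∀ m a, ‖f (a + p ^ m) - f a‖ ≤ ‖(p : K)‖ ^ m) (m : ℕ) :
    ∃ n, ∀ k ≥ n, ∀ a, ‖(fwdDiff 1)^[k] f a‖ ≤ ‖(p : K)‖ ^ m := by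
  induction m with
  | zero => exact ⟨0, fun k _ a => by simpa using norm_fwdDiff_iter_le hf k a⟩
  | succ m ih =>
    obtain ⟨n, hn⟩ := ih
    refine ⟨n + p ^ (m + 1), fun k hk a => ?_⟩
    obtain ⟨l, rfl⟩ : ∃ l, k = p ^ (m + 1) + l := ⟨k - p ^ (m + 1), by omega⟩
    set q := p ^ (m + 1) with hq
    have hq0 : 0 < q := pow_pos (Fact.out : p.Prime).pos _
    rw [Function.iterate_add_apply]
    set F := (fwdDiff 1)^[l] f with hF
    have hFle : ∀ b, ‖F b‖ ≤ ‖(p : K)‖ ^ m := hn l (by omega)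
    have hFq : ‖F (a + q) - F a‖ ≤ ‖(p : K)‖ ^ (m + 1) := by
      rw [hF, ← fwdDiff_iter_comp_add, ← fwdDiff_iter_sub]
      exact norm_fwdDiff_iter_le (hc (m + 1)) l a
    have hsum := shift_eq_sum_fwdDiff_iter 1 F q a
    obtain ⟨r, hr⟩ : ∃ r, q = r + 1 := ⟨q - 1, by omega⟩
    rw [sum_range_succ, hr, sum_range_succ', ← hr] at hsum
    simp only [smul_eq_mul, mul_one, Nat.choose_self, Nat.choose_zero_right, one_smul,
      Function.iterate_zero, id_eq] at hsum
    have : (fwdDiff 1)^[q] F a = (F (a + q) - F a) -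
        ∑ i ∈ range r, q.choose (i + 1) • (fwdDiff 1)^[i + 1] F a := by
      rw [hsum]; ring
    rw [this]
    refine norm_sub_le_of_le hFq (norm_sum_le_of_forall_norm_le (by positivity) fun i hi => ?_)
    rw [mem_range] at hi
    have hdvd : p ∣ q.choose (i + 1) :=
      (Fact.out : p.Prime).dvd_choose_pow (by omega) (by omega)
    rw [nsmul_eq_mul, norm_mul, pow_succ']
    refine mul_le_mul ?_ (norm_fwdDiff_iter_le hFle _ _) (norm_nonneg _) (norm_nonneg _)
    have := norm_intCast_le_pow_of_dvd (K := K) (p := p) (m := 1) (z := (q.choose (i + 1) : ℤ))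
      (by simpa using Int.natCast_dvd_natCast.2 hdvd)
    simpa using this

end Ultrametric

/-! ### Factorials and the splitting function -/

section Splitting

variable {K : Type*} [NormedField K]

/-- The quotient `(-p) ^ a a! / (p a + t)!`. -/
noncomputable def factorialQuotient (K : Type*) [Field K] (p t a : ℕ) : K :=
  (-(p : K)) ^ a * a.factorial / (p * a + t).factorial

theorem factorialQuotient_zero (p t : ℕ) : factorialQuotient K p t 0 = (t.factorial : K)⁻¹ := by
  simp [factorialQuotient]

theorem factorialQuotient_succ [CharZero K] {p t : ℕ} (ht : t < p) (a : ℕ) :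
    factorialQuotient K p t (a + 1) * (unitBlock p t a : K) = factorialQuotient K p t a := by
  have h := congrArg (Int.cast : ℤ → K) (factorial_block ht a)
  have h0 : ((p * (a + 1) + t).factorial : K) ≠ 0 := Nat.cast_ne_zero.2 (Nat.factorial_ne_zero _)
  push_cast at h
  rw [factorialQuotient, factorialQuotient, h]
  rw [h] at h0
  have h1 : ((p * a + t).factorial : K) ≠ 0 := Nat.cast_ne_zero.2 (Nat.factorial_ne_zero _)
  have h2 : (unitBlock p t a : K) ≠ 0 := fun h => h0 (by rw [h]; ring)
  have h3 : (p : K) ≠ 0 := fun h => h0 (by rw [h]; ring)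
  have h4 : (a + 1 : K) ≠ 0 := by exact_mod_cast Nat.succ_ne_zero a
  rw [Nat.factorial_succ]
  push_cast
  field_simp
  ring

theorem factorialQuotient_add [CharZero K] {p t : ℕ} (ht : t < p) (a n : ℕ) :
    factorialQuotient K p t (a + n) * ∏ k ∈ range n, (unitBlock p t (a + k) : K) =
      factorialQuotient K p t a := by
  induction n with
  | zero => simp
  | succ n ih =>
    rw [prod_range_succ, ← ih, ← factorialQuotient_succ ht (a + n), ← add_assoc]
    ring

variable {p : ℕ} [Fact p.Prime]

theorem norm_natCast_factorial_of_lt [IsUltrametricDist K] (hpK : ‖(p : K)‖ < 1)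
    {t : ℕ} (ht : t < p) : ‖(t.factorial : K)‖ = 1 := by
  have hcop : IsCoprime ((t.factorial : ℕ) : ℤ) (p : ℤ) :=
    Nat.isCoprime_iff_coprime.2 ((Nat.coprime_factorial_iff (Fact.out : p.Prime).one_lt.ne').2
      (by rwa [(Fact.out : p.Prime).minFac_eq])).symm
  obtain ⟨x, y, hxy⟩ := hcop
  have h1 := norm_intCast_eq_one_of_modEq hpK (z := x * t.factorial)
    (Int.modEq_iff_dvd.2 ⟨y, by rw [← hxy]; ring⟩)
  push_cast at h1
  rw [norm_mul] at h1
  have h2 := IsUltrametricDist.norm_intCast_le_one K x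
  have h3 := IsUltrametricDist.norm_natCast_le_one K t.factorial
  have h4 := norm_nonneg (x : K)
  have h5 := norm_nonneg (t.factorial : K)
  nlinarith

theorem norm_factorialQuotient [CharZero K] [IsUltrametricDist K] (hpK : ‖(p : K)‖ < 1)
    {t : ℕ} (ht : t < p) (a : ℕ) : ‖factorialQuotient K p t a‖ = 1 := by
  have h := congrArg norm (factorialQuotient_add (K := K) ht 0 a)
  rw [norm_mul, norm_prod, prod_congr rfl fun k _ =>
    norm_intCast_eq_one_of_modEq hpK (unitBlock_modEq_one ht (0 + k)), factorialQuotient_zero,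
    norm_inv, norm_natCast_factorial_of_lt hpK ht] at h
  simpa using h

theorem norm_factorialQuotient_add_pow_sub [CharZero K] [IsUltrametricDist K] (hpK : ‖(p : K)‖ < 1)
    {t : ℕ} (ht : t < p) (m a : ℕ) :
    ‖factorialQuotient K p t (a + p ^ m) - factorialQuotient K p t a‖ ≤ ‖(p : K)‖ ^ m := by
  rw [← factorialQuotient_add ht a (p ^ m), ← Int.cast_prod]
  set P := ∏ k ∈ range (p ^ m), unitBlock p t (a + k) with hP
  have h1 : P ≡ 1 [ZMOD (p : ℤ) ^ m] :=
    prod_range_pow_modEq_one (unitBlock_modEq_one ht) (unitBlock_add_pow p t) m a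
  have h2 := norm_intCast_le_pow_of_dvd (K := K) h1.dvd
  have : factorialQuotient K p t (a + p ^ m) - factorialQuotient K p t (a + p ^ m) * (P : K) =
      factorialQuotient K p t (a + p ^ m) * ((1 - P : ℤ) : K) := by
    push_cast; ring
  rw [this, norm_mul, norm_factorialQuotient hpK ht, one_mul]
  exact h2

theorem norm_factorialQuotient_succ_sub [CharZero K] [IsUltrametricDist K] (hpK : ‖(p : K)‖ < 1)
    {t : ℕ} (ht : t < p) (a : ℕ) :
    ‖factorialQuotient K p t (a + 1) - factorialQuotient K p t a‖ ≤ ‖(p : K)‖ := by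
  rw [← factorialQuotient_succ ht a]
  have h2 := norm_intCast_le_pow_of_dvd (K := K) (p := p) (m := 1)
    (by simpa using (unitBlock_modEq_one ht a).dvd)
  have : factorialQuotient K p t (a + 1) - factorialQuotient K p t (a + 1) * (unitBlock p t a : K) =
      factorialQuotient K p t (a + 1) * ((1 - unitBlock p t a : ℤ) : K) := by
    push_cast; ring
  rw [this, norm_mul, norm_factorialQuotient hpK ht, one_mul]
  simpa using h2

variable {ϖ : K}

theorem pow_div_factorial_mul_add [CharZero K] (hϖ : ϖ ^ (p - 1) = -(p : K)) (a t : ℕ) :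
    ϖ ^ (p * a + t) / (p * a + t).factorial =
      ϖ ^ t * (ϖ ^ a / a.factorial) * factorialQuotient K p t a := by
  have h0 : (a.factorial : K) ≠ 0 := Nat.cast_ne_zero.2 (Nat.factorial_ne_zero _)
  have hp := (Fact.out : p.Prime).one_lt
  have : ϖ ^ (p * a + t) = ϖ ^ t * ϖ ^ a * (-(p : K)) ^ a := by
    rw [← hϖ, ← pow_mul, ← pow_add, ← pow_add]
    congr 1
    obtain ⟨r, rfl⟩ : ∃ r, p = r + 1 := ⟨p - 1, by omega⟩
    simp
    ring
  rw [factorialQuotient, this]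
  field_simp

theorem norm_pow_div_factorial [CharZero K] [IsUltrametricDist K] (hpK : ‖(p : K)‖ < 1)
    (hϖ : ϖ ^ (p - 1) = -(p : K)) (a : ℕ) :
    ‖ϖ ^ a / (a.factorial : K)‖ = ‖ϖ‖ ^ weight p a := by
  induction a using Nat.strong_induction_on with
  | _ a ih =>
    have hp := (Fact.out : p.Prime).one_lt
    rcases Nat.eq_zero_or_pos a with rfl | ha
    · simp [weight_zero]
    · have hm := Nat.mod_lt a (show 0 < p by omega)
      have h1 := weight_mul_add hp (a / p) hm
      have h2 := pow_div_factorial_mul_add hϖ (a / p) (a % p)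
      rw [Nat.div_add_mod] at h1 h2
      rw [h1, h2, norm_mul, norm_mul, ih _ (Nat.div_lt_self ha hp), norm_factorialQuotient hpK hm,
        norm_pow, pow_add]
      ring

theorem norm_uniformizer_lt_one (hpK : ‖(p : K)‖ < 1) (hϖ : ϖ ^ (p - 1) = -(p : K)) : ‖ϖ‖ < 1 := by
  have h := congrArg norm hϖ
  rw [norm_pow, norm_neg] at h
  exact (pow_lt_one_iff_of_nonneg (norm_nonneg _)
    (by have := (Fact.out : p.Prime).one_lt; omega)).1 (h ▸ hpK)

theorem norm_natCast_le_norm_uniformizer (hpK : ‖(p : K)‖ < 1) (hϖ : ϖ ^ (p - 1) = -(p : K))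
    : ‖(p : K)‖ ≤ ‖ϖ‖ := by
  have h := congrArg norm hϖ
  rw [norm_pow, norm_neg] at h
  rw [← h]
  exact pow_le_of_le_one (norm_nonneg _) (norm_uniformizer_lt_one hpK hϖ).le
    (by have := (Fact.out : p.Prime).one_lt; omega)

end Splitting

end DworkHasse

namespace DworkHasse

open Finset PowerSeries

/-! ### Coefficients of the splitting function -/

section Formal

variable {K : Type*} [Field K]

theorem constantCoeff_exp_subst [CharZero K] {g : PowerSeries K} (hg : constantCoeff g = 0) :
    constantCoeff ((exp K).subst g) = 1 := by
  rw [← coeff_zero_eq_constantCoeff_apply, coeff_subst' (.of_constantCoeff_zero' hg),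
    finsum_eq_single _ 0]
  · simp
  · intro n hn
    simp [hg, hn]

theorem derivative_exp_subst [CharZero K] {g : PowerSeries K} (hg : constantCoeff g = 0) :
    derivative K ((exp K).subst g) = (exp K).subst g * derivative K g := by
  rw [derivative_subst (.of_constantCoeff_zero' hg), derivative_exp]

theorem exp_subst_mul_exp_subst_neg [CharZero K] {g : PowerSeries K} (hg : constantCoeff g = 0) :
    (exp K).subst g * (exp K).subst (-g) = 1 := by
  have hg' : constantCoeff (-g) = 0 := by simp [hg]
  apply derivative.ext
  · rw [Derivation.leibniz, derivative_exp_subst hg, derivative_exp_subst hg', map_neg,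
      Derivation.map_one_eq_zero]
    simp only [smul_eq_mul]
    ring
  · rw [map_mul, constantCoeff_exp_subst hg, constantCoeff_exp_subst hg']
    simp

theorem exp_subst_add [CharZero K] {g h : PowerSeries K} (hg : constantCoeff g = 0)
    (hh : constantCoeff h = 0) :
    (exp K).subst (g + h) = (exp K).subst g * (exp K).subst h := by
  have hg' : constantCoeff (-g) = 0 := by simp [hg]
  have hh' : constantCoeff (-h) = 0 := by simp [hh]
  have hgh : constantCoeff (g + h) = 0 := by simp [hg, hh]
  have key : (exp K).subst (g + h) * (exp K).subst (-g) * (exp K).subst (-h) = 1 := by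
    apply derivative.ext
    · rw [Derivation.leibniz, Derivation.leibniz, derivative_exp_subst hg',
        derivative_exp_subst hh', derivative_exp_subst hgh, map_neg, map_neg, map_add,
        Derivation.map_one_eq_zero]
      simp only [smul_eq_mul]
      ring
    · rw [map_mul, map_mul, constantCoeff_exp_subst hg', constantCoeff_exp_subst hh',
        constantCoeff_exp_subst hgh]
      simp
  calc (exp K).subst (g + h)
      = (exp K).subst (g + h) * ((exp K).subst g * (exp K).subst (-g)) *
          ((exp K).subst h * (exp K).subst (-h)) := by
        rw [exp_subst_mul_exp_subst_neg hg, exp_subst_mul_exp_subst_neg hh, mul_one, mul_one]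
    _ = ((exp K).subst (g + h) * (exp K).subst (-g) * (exp K).subst (-h)) *
          ((exp K).subst g * (exp K).subst h) := by ring
    _ = _ := by rw [key, one_mul]

theorem coeff_subst_C_mul_X_pow {d : ℕ} (hd : 0 < d) (f : PowerSeries K) (a : K) (n : ℕ) :
    coeff n (f.subst (C a * X ^ d)) = if d ∣ n then a ^ (n / d) * coeff (n / d) f else 0 := by
  have hs : HasSubst (C a * X ^ d : PowerSeries K) :=
    .of_constantCoeff_zero' (by simp [hd.ne'])
  rw [coeff_subst' hs]
  have hc : ∀ k, coeff k f • coeff n ((C a * X ^ d : PowerSeries K) ^ k) =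
      if n = d * k then a ^ k * coeff k f else 0 := by
    intro k
    rw [mul_pow, ← map_pow, ← pow_mul, coeff_C_mul, coeff_X_pow]
    split_ifs <;> simp [mul_comm]
  simp only [hc]
  split_ifs with h
  · obtain ⟨m, rfl⟩ := h
    rw [Nat.mul_div_cancel_left _ hd, finsum_eq_single _ m]
    · simp
    · intro k hk
      rw [if_neg]
      intro h
      exact hk (Nat.eq_of_mul_eq_mul_left hd h).symm
  · rw [finsum_eq_zero_of_forall_eq_zero]
    intro k
    rw [if_neg]
    rintro rfl
    exact h (dvd_mul_right _ _)

theorem theta_eq_mul [CharZero K] {p : ℕ} (hp : 0 < p) (ϖ : K) :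
    theta p ϖ = (exp K).subst (C ϖ * X ^ 1) * (exp K).subst (C (-ϖ) * X ^ p) := by
  rw [theta, ← exp_subst_add (by simp) (by simp [hp.ne'])]
  congr 1
  simp only [map_neg, pow_one]
  ring

theorem coeff_theta_mul_add [CharZero K] {p : ℕ} {t : ℕ} (ht : t < p) (ϖ : K) (n : ℕ) :
    coeff (p * n + t) (theta p ϖ) = ∑ x ∈ antidiagonal n,
      ϖ ^ (p * x.1 + t) / (p * x.1 + t).factorial * ((-ϖ) ^ x.2 / x.2.factorial) := by
  have hp : 0 < p := by omega
  rw [theta_eq_mul hp, coeff_mul]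
  symm
  refine sum_of_injOn (fun x => (p * x.1 + t, p * x.2)) ?_ ?_ ?_ ?_
  · rintro ⟨a, b⟩ - ⟨a', b'⟩ - h
    simp only [Prod.mk.injEq, add_left_inj] at h
    exact Prod.ext (Nat.eq_of_mul_eq_mul_left hp h.1) (Nat.eq_of_mul_eq_mul_left hp h.2)
  · rintro ⟨a, b⟩ h
    simp only [mem_coe, HasAntidiagonal.mem_antidiagonal] at h ⊢
    rw [← h]
    ring
  · rintro ⟨i, l⟩ h h'
    rw [HasAntidiagonal.mem_antidiagonal] at h
    rw [coeff_subst_C_mul_X_pow hp]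
    split_ifs with hd
    · exfalso
      obtain ⟨b, rfl⟩ := hd
      apply h'
      simp only at h
      have hb : b ≤ n := by
        by_contra hc
        have : p * (n + 1) ≤ p * b := Nat.mul_le_mul_left _ (by omega)
        rw [mul_add] at this
        omega
      refine ⟨(n - b, b), by simp [Nat.sub_add_cancel hb], ?_⟩
      simp only [Prod.mk.injEq, and_true]
      rw [Nat.mul_sub]
      have := Nat.mul_le_mul_left p hb
      omega
    · simp
  · rintro ⟨a, b⟩ -
    simp only
    rw [coeff_subst_C_mul_X_pow hp, coeff_subst_C_mul_X_pow one_pos]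
    simp [hp, coeff_exp, div_eq_mul_inv]

theorem coeff_F₁ [CharZero K]
    {p : ℕ} (ϖ : K) {D : Finset ℕ} (hpos : ∀ d ∈ D, 0 < d) (a : D → K) {n B : ℕ}
    (hB : n < B) :
    coeff n (F₁ p ϖ D a) =
      ∑ u ∈ (Fintype.piFinset fun _ : D => range B) with dot D u = n,
        ∏ d : D, (a d ^ u d * coeff (u d) (theta p ϖ)) := by
  classical
  rw [F₁, coeff_prod]
  symm
  refine sum_of_injOn (fun u => Finsupp.equivFunOnFinite.symm fun d : D => (d : ℕ) * u d)
    ?_ ?_ ?_ ?_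
  · intro u _ v _ h
    have h := Finsupp.equivFunOnFinite.symm.injective h
    funext d
    exact Nat.eq_of_mul_eq_mul_left (hpos d d.2) (congrFun h d)
  · intro u hu
    rw [mem_coe, mem_filter] at hu
    rw [mem_coe, mem_finsuppAntidiag]
    exact ⟨hu.2, subset_univ _⟩
  · intro l hl hl'
    rw [mem_finsuppAntidiag] at hl
    by_contra hne
    apply hl'
    have hdvd : ∀ d : D, (d : ℕ) ∣ l d := by
      intro d
      have := (Finset.prod_ne_zero_iff.1 hne) d (mem_univ d)
      rw [coeff_subst_C_mul_X_pow (hpos d d.2)] at this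
      by_contra hc
      simp [hc] at this
    refine ⟨fun d => l d / d, ?_, ?_⟩
    · have e : ∀ d : D, (d : ℕ) * (l d / d) = l d := fun d => Nat.mul_div_cancel' (hdvd d)
      rw [mem_coe, mem_filter, Fintype.mem_piFinset]
      simp only [mem_range, dot, e]
      refine ⟨fun d => lt_of_le_of_lt (Nat.div_le_self _ _) (lt_of_le_of_lt ?_ hB), hl.1⟩
      rw [← hl.1]
      exact single_le_sum (f := fun d => l d) (fun _ _ => Nat.zero_le _) (mem_univ d)
    · ext d
      simp [Nat.mul_div_cancel' (hdvd d)]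
  · intro u _
    refine prod_congr rfl fun d _ => ?_
    rw [coeff_subst_C_mul_X_pow (hpos d d.2)]
    simp [Nat.mul_div_cancel_left _ (hpos d d.2)]

end Formal

section Norm

variable {K : Type*} [NormedField K] {p : ℕ} [Fact p.Prime] {ϖ : K}

theorem coeff_theta_eq_fwdDiff [CharZero K]
    (hϖ : ϖ ^ (p - 1) = -(p : K)) {t : ℕ} (ht : t < p) (n : ℕ) :
    coeff (p * n + t) (theta p ϖ) =
      ϖ ^ t * (ϖ ^ n / n.factorial) * (fwdDiff 1)^[n] (factorialQuotient K p t) 0 := by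
  rw [coeff_theta_mul_add ht, fwdDiff_iter_eq_sum_shift, Nat.sum_antidiagonal_eq_sum_range_succ_mk,
    mul_sum]
  refine sum_congr rfl fun a ha => ?_
  have ha' : a ≤ n := by simpa [Nat.lt_succ_iff] using ha
  rw [pow_div_factorial_mul_add hϖ]
  obtain ⟨b, rfl⟩ := Nat.exists_eq_add_of_le ha'
  have h1 : (((a + b).choose a : ℕ) : K) * a.factorial * b.factorial = (a + b).factorial := by
    exact_mod_cast Nat.choose_symm_add (a := a) (b := b) ▸
      Nat.add_choose_mul_factorial_mul_factorial a b
  have ha0 : (a.factorial : K) ≠ 0 := Nat.cast_ne_zero.2 (Nat.factorial_ne_zero _)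
  have hb0 : (b.factorial : K) ≠ 0 := Nat.cast_ne_zero.2 (Nat.factorial_ne_zero _)
  have hab0 : ((a + b).factorial : K) ≠ 0 := Nat.cast_ne_zero.2 (Nat.factorial_ne_zero _)
  simp only [Nat.add_sub_cancel_left, smul_eq_mul, mul_one, zero_add, zsmul_eq_mul, Int.cast_mul,
    Int.cast_pow, Int.cast_neg, Int.cast_one, Int.cast_natCast]
  have h2 : (((a + b).choose a : ℕ) : K) = (a + b).factorial / (a.factorial * b.factorial) := by
    rw [eq_div_iff (mul_ne_zero ha0 hb0), ← h1, mul_assoc]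
  rw [h2, neg_pow ϖ b, pow_add ϖ a b]
  field_simp

theorem coeff_theta_of_lt [CharZero K] (hϖ : ϖ ^ (p - 1) = -(p : K)) {t : ℕ} (ht : t < p) :
    coeff t (theta p ϖ) = ϖ ^ t / t.factorial := by
  have := coeff_theta_eq_fwdDiff hϖ ht 0
  simpa [factorialQuotient_zero, div_eq_mul_inv] using this

theorem norm_coeff_theta_le [CharZero K] [IsUltrametricDist K]
    (hpK : ‖(p : K)‖ < 1) (hϖ : ϖ ^ (p - 1) = -(p : K)) (u : ℕ) :
    ‖coeff u (theta p ϖ)‖ ≤ ‖ϖ‖ ^ weight p u := by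
  have hp := (Fact.out : p.Prime).one_lt
  have hm := Nat.mod_lt u (show 0 < p by omega)
  have h1 := weight_mul_add hp (u / p) hm
  have h2 := coeff_theta_eq_fwdDiff hϖ hm (u / p)
  rw [Nat.div_add_mod] at h1 h2
  rw [h1, h2, norm_mul, norm_mul, norm_pow_div_factorial hpK hϖ, norm_pow, pow_add,
    mul_comm (‖ϖ‖ ^ (u % p))]
  exact mul_le_of_le_one_right (by positivity)
    (norm_fwdDiff_iter_le (fun a => (norm_factorialQuotient hpK hm a).le) _ _)

theorem norm_coeff_theta_le_of_le [CharZero K] [IsUltrametricDist K]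
    (hpK : ‖(p : K)‖ < 1) (hϖ : ϖ ^ (p - 1) = -(p : K)) {u : ℕ}
    (hu : p ≤ u) : ‖coeff u (theta p ϖ)‖ ≤ ‖ϖ‖ ^ (weight p u + 1) := by
  have hp := (Fact.out : p.Prime).one_lt
  have hm := Nat.mod_lt u (show 0 < p by omega)
  have h1 := weight_mul_add hp (u / p) hm
  have h2 := coeff_theta_eq_fwdDiff hϖ hm (u / p)
  rw [Nat.div_add_mod] at h1 h2
  obtain ⟨n, hn⟩ : ∃ n, u / p = n + 1 := ⟨u / p - 1, by
    have := Nat.div_pos hu (show 0 < p by omega); omega⟩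
  rw [h1, h2, norm_mul, norm_mul, norm_pow_div_factorial hpK hϖ, norm_pow, pow_succ, pow_add,
    mul_comm (‖ϖ‖ ^ (u % p)), hn, Function.iterate_succ_apply]
  refine mul_le_mul_of_nonneg_left ?_ (by positivity)
  exact (norm_fwdDiff_iter_le (norm_factorialQuotient_succ_sub hpK hm) _ _).trans
    (norm_natCast_le_norm_uniformizer hpK hϖ)

theorem tendsto_coeff_theta [CharZero K] [IsUltrametricDist K]
    (hpK : ‖(p : K)‖ < 1) (hϖ : ϖ ^ (p - 1) = -(p : K)) :
    Filter.Tendsto (fun u => coeff u (theta p ϖ)) Filter.atTop (nhds 0) := by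
  have hp := (Fact.out : p.Prime).one_lt
  rw [Metric.tendsto_atTop]
  intro ε hε
  obtain ⟨m, hm⟩ := exists_pow_lt_of_lt_one hε hpK
  choose! n hn using fun t (ht : t < p) => exists_forall_norm_fwdDiff_iter_le (p := p)
    (fun a => (norm_factorialQuotient (K := K) hpK ht a).le)
    (norm_factorialQuotient_add_pow_sub hpK ht) m
  refine ⟨p * (∑ t ∈ range p, n t), fun u hu => ?_⟩
  have ht := Nat.mod_lt u (show 0 < p by omega)
  have h2 := coeff_theta_eq_fwdDiff hϖ ht (u / p)
  rw [Nat.div_add_mod] at h2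
  have hle : n (u % p) ≤ u / p := by
    rw [Nat.le_div_iff_mul_le (by omega), mul_comm]
    exact (Nat.mul_le_mul_left _
      (single_le_sum (fun _ _ => Nat.zero_le _) (mem_range.2 ht))).trans hu
  rw [dist_zero_right, h2, norm_mul, norm_mul, norm_pow_div_factorial hpK hϖ, norm_pow]
  refine lt_of_le_of_lt ?_ hm
  refine (mul_le_of_le_one_left (norm_nonneg _) ?_).trans (hn _ ht _ hle 0)
  have hϖ1 := (norm_uniformizer_lt_one hpK hϖ).le
  exact mul_le_one₀ (pow_le_one₀ (norm_nonneg _) hϖ1) (by positivity)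
    (pow_le_one₀ (norm_nonneg _) hϖ1)

theorem norm_prod_le_pow_sum {ι : Type*} (s : Finset ι) {f : ι → K} {c : ℝ} {e : ι → ℕ}
    (h : ∀ i ∈ s, ‖f i‖ ≤ c ^ e i) : ‖∏ i ∈ s, f i‖ ≤ c ^ ∑ i ∈ s, e i := by
  rw [norm_prod, ← prod_pow_eq_pow_sum]
  exact prod_le_prod (fun _ _ => norm_nonneg _) h

theorem norm_coeff_F₁_le_one [CharZero K] [IsUltrametricDist K]
    (hpK : ‖(p : K)‖ < 1) (hϖ : ϖ ^ (p - 1) = -(p : K)) {D : Finset ℕ}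
    (hpos : ∀ d ∈ D, 0 < d) {a : D → K} (ha : ∀ d, ‖a d‖ ≤ 1) (n : ℕ) :
    ‖coeff n (F₁ p ϖ D a)‖ ≤ 1 := by
  rw [coeff_F₁ ϖ hpos a (Nat.lt_succ_self n)]
  refine norm_sum_le_of_forall_norm_le zero_le_one fun u _ => ?_
  rw [norm_prod]
  refine prod_le_one (fun _ _ => norm_nonneg _) fun d _ => ?_
  rw [norm_mul, norm_pow]
  exact mul_le_one₀ (pow_le_one₀ (norm_nonneg _) (ha d)) (norm_nonneg _)
    ((norm_coeff_theta_le hpK hϖ _).trans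
      (pow_le_one₀ (norm_nonneg _) (norm_uniformizer_lt_one hpK hϖ).le))

theorem tendsto_coeff_F₁ [CharZero K] [IsUltrametricDist K]
    (hpK : ‖(p : K)‖ < 1) (hϖ : ϖ ^ (p - 1) = -(p : K)) {D : Finset ℕ}
    (hpos : ∀ d ∈ D, 0 < d) {a : D → K} (ha : ∀ d, ‖a d‖ ≤ 1) :
    Filter.Tendsto (fun n => coeff n (F₁ p ϖ D a)) Filter.atTop (nhds 0) := by
  rw [Metric.tendsto_atTop]
  intro ε hε
  obtain ⟨B, hB⟩ := Metric.tendsto_atTop.1 (tendsto_coeff_theta hpK hϖ) (ε / 2) (half_pos hε)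
  refine ⟨(∑ d : D, (d : ℕ)) * B + 1, fun n hn => ?_⟩
  rw [dist_zero_right, coeff_F₁ ϖ hpos a (Nat.lt_succ_self n)]
  refine lt_of_le_of_lt (norm_sum_le_of_forall_norm_le (half_pos hε).le fun u hu => ?_)
    (half_lt_self hε)
  have hdot : dot D u = n := (mem_filter.1 hu).2
  obtain ⟨d₀, hd₀⟩ : ∃ d, B ≤ u d := by
    by_contra! hc
    have : dot D u ≤ (∑ d : D, (d : ℕ)) * B := by
      rw [dot, sum_mul]
      exact sum_le_sum fun d _ => Nat.mul_le_mul_left _ (hc d).le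
    omega
  have hle : ∀ d : D, ‖a d ^ u d * coeff (u d) (theta p ϖ)‖ ≤ ‖coeff (u d) (theta p ϖ)‖ := by
    intro d
    rw [norm_mul, norm_pow]
    exact mul_le_of_le_one_left (norm_nonneg _) (pow_le_one₀ (norm_nonneg _) (ha d))
  rw [norm_prod, ← mul_prod_erase _ _ (mem_univ d₀)]
  have h1 := hB _ hd₀
  rw [dist_zero_right] at h1
  refine (mul_le_of_le_one_right (norm_nonneg _) ?_).trans ((hle d₀).trans h1.le)
  refine prod_le_one (fun _ _ => norm_nonneg _) fun d _ => (hle d).trans ?_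
  exact (norm_coeff_theta_le hpK hϖ _).trans
    (pow_le_one₀ (norm_nonneg _) (norm_uniformizer_lt_one hpK hϖ).le)

end Norm

end DworkHasse

namespace DworkHasse

open Finset Filter Topology

/-! ### Existence of Fredholm determinants -/

theorem coeff_charpolyRev_submatrix {ι R : Type*} [DecidableEq ι] [CommRing R] (A : Matrix ι ι R)
    (S : Finset ι) (n : ℕ) :
    (A.submatrix (Subtype.val : S → ι) Subtype.val).charpolyRev.coeff n =
      (-1) ^ n * ∑ s ∈ S.powersetCard n, (A.submatrix (Subtype.val : s → ι) Subtype.val).det := by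
  set M := A.submatrix (Subtype.val : S → ι) Subtype.val with hM
  have hrev : M.charpolyRev =
      Matrix.det (1 + (Polynomial.X : Polynomial R) • (-M).map Polynomial.C) := by
    simp only [Matrix.charpolyRev, sub_eq_add_neg]
    congr 2
    rw [Matrix.map_neg Polynomial.C (map_neg Polynomial.C) M, smul_neg]
  rw [hrev, Matrix.coeff_det_one_add_X_smul_eq_sum_minors, mul_sum]
  refine sum_nbij (fun s => s.map (Function.Embedding.subtype _)) ?_ ?_ ?_ ?_
  · intro s hs
    rw [mem_powersetCard] at hs ⊢
    refine ⟨fun x hx => ?_, by rw [card_map, hs.2]⟩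
    obtain ⟨y, -, rfl⟩ := mem_map.1 hx
    exact y.2
  · intro s _ t _ h
    exact map_injective _ h
  · intro s hs
    rw [mem_coe, mem_powersetCard] at hs
    refine ⟨s.subtype (· ∈ S), ?_, ?_⟩
    · rw [mem_coe, mem_powersetCard]
      refine ⟨subset_univ _, ?_⟩
      rw [← card_map (Function.Embedding.subtype _), subtype_map_of_mem fun x hx => hs.1 hx, hs.2]
    · exact subtype_map_of_mem fun x hx => hs.1 hx
  · intro s hs
    rw [mem_powersetCard] at hs
    rw [show (-M).submatrix (Subtype.val : s → S) Subtype.val = -M.submatrix Subtype.val Subtype.val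
      from rfl, Matrix.det_neg, Fintype.card_coe, hs.2]
    congr 1
    let e : s ≃ (s.map (Function.Embedding.subtype (· ∈ S))) :=
      Equiv.ofBijective
        (fun x => ⟨x.1.1, mem_map_of_mem (Function.Embedding.subtype (· ∈ S)) x.2⟩)
        ⟨fun x y h => Subtype.ext (Subtype.ext (Subtype.mk.inj h)), fun y => by
          obtain ⟨x, hx, hxy⟩ := mem_map.1 y.2
          exact ⟨⟨x, hx⟩, Subtype.ext hxy⟩⟩
    rw [← Matrix.det_submatrix_equiv_self e]
    rfl

theorem exists_isFredholmDet_of_tendsto {ι K : Type*} [DecidableEq ι] [NormedField K]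
    [IsUltrametricDist K] [CompleteSpace K] (A : Matrix ι ι K)
    (h : Tendsto (fun s : Finset ι => (A.submatrix (Subtype.val : s → ι) Subtype.val).det)
      cofinite (𝓝 0)) : ∃ P, IsFredholmDet A P := by
  have hsum : ∀ n : ℕ, Summable fun s : Finset ι =>
      if s.card = n then (A.submatrix (Subtype.val : s → ι) Subtype.val).det else 0 := by
    intro n
    apply NonarchimedeanAddGroup.summable_of_tendsto_cofinite_zero
    rw [tendsto_zero_iff_norm_tendsto_zero] at h ⊢
    refine squeeze_zero (fun _ => norm_nonneg _) (fun s => ?_) h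
    split_ifs
    · exact le_rfl
    · simp
  have hpow : Tendsto (fun S : Finset ι => S.powerset) atTop atTop :=
    tendsto_atTop_finset_of_monotone (fun _ _ h => powerset_mono.2 h)
      fun s => ⟨s, mem_powerset_self s⟩
  refine ⟨PowerSeries.mk fun n => (-1) ^ n * ∑' s : Finset ι,
    if s.card = n then (A.submatrix (Subtype.val : s → ι) Subtype.val).det else 0, fun n => ?_⟩
  have := ((hsum n).hasSum.comp hpow).const_mul ((-1) ^ n)
  rw [PowerSeries.coeff_mk]
  refine this.congr fun S => ?_
  rw [coeff_charpolyRev_submatrix]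
  congr 1
  rw [Function.comp_apply, ← sum_filter, ← powersetCard_eq_filter]

/-- If the entries of a matrix over a complete ultrametric field are bounded by one, and those on
and to the left of the diagonal tend to zero with the row index, then the Fredholm determinant
exists. -/
theorem exists_isFredholmDet {K : Type*} [NormedField K] [IsUltrametricDist K] [CompleteSpace K]
    (A : Matrix ℕ+ ℕ+ K) (h1 : ∀ i j, ‖A i j‖ ≤ 1)
    (h2 : ∀ ε > 0, ∃ M : ℕ+, ∀ i j, M ≤ i → j ≤ i → ‖A i j‖ ≤ ε) : ∃ P, IsFredholmDet A P := by
  apply exists_isFredholmDet_of_tendsto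
  rw [Metric.tendsto_nhds]
  intro ε hε
  obtain ⟨M, hM⟩ := h2 (ε / 2) (half_pos hε)
  rw [Filter.eventually_cofinite]
  refine (Finset.finite_toSet (Finset.Icc 1 M).powerset).subset fun s hs => ?_
  rw [mem_coe, mem_powerset]
  by_contra hc
  refine hs ?_
  rw [dist_zero_right]
  refine lt_of_le_of_lt ?_ (half_lt_self hε)
  obtain ⟨m, hm, hmM⟩ := not_subset.1 hc
  have hne : s.Nonempty := ⟨m, hm⟩
  have hmax := s.max'_mem hne
  have hMle : M ≤ s.max' hne := by
    have h3 := s.le_max' m hm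
    have h4 : M < m := by simpa using hmM
    exact h4.le.trans h3
  rw [← Matrix.det_transpose, Matrix.det_apply]
  refine norm_sum_le_of_forall_norm_le (half_pos hε).le fun σ _ => ?_
  rw [Units.smul_def, zsmul_eq_mul, norm_mul]
  refine (mul_le_of_le_one_left (norm_nonneg _)
    (IsUltrametricDist.norm_intCast_le_one K _)).trans ?_
  rw [norm_prod, ← mul_prod_erase _ _ (mem_univ ⟨s.max' hne, hmax⟩)]
  refine (mul_le_of_le_one_right (norm_nonneg _)
    (prod_le_one (fun _ _ => norm_nonneg _) fun _ _ => h1 _ _)).trans ?_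
  exact hM _ _ hMle (s.le_max' _ (σ _).2)

theorem exists_isFredholmDet_A₁ {K : Type*} [NormedField K] [CharZero K] [IsUltrametricDist K]
    [CompleteSpace K] {p : ℕ} [Fact p.Prime] {ϖ : K} (hpK : ‖(p : K)‖ < 1)
    (hϖ : ϖ ^ (p - 1) = -(p : K)) {D : Finset ℕ} (hpos : ∀ d ∈ D, 0 < d) {a : D → K}
    (ha : ∀ d, ‖a d‖ ≤ 1) : ∃ P, IsFredholmDet (A₁ p ϖ D a) P := by
  apply exists_isFredholmDet
  · intro i j
    rw [A₁_apply]
    split_ifs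
    · exact norm_coeff_F₁_le_one hpK hϖ hpos ha _
    · simp
  · intro ε hε
    obtain ⟨M, hM⟩ := Metric.tendsto_atTop.1 (tendsto_coeff_F₁ hpK hϖ hpos ha) ε hε
    refine ⟨M.succPNat, fun i j hi hj => ?_⟩
    rw [A₁_apply]
    have hi' : M + 1 ≤ (i : ℕ) := by exact_mod_cast hi
    have hj' : (j : ℕ) ≤ i := by exact_mod_cast hj
    have h2 : 2 * (i : ℕ) ≤ p * i := Nat.mul_le_mul_right _ (Fact.out : p.Prime).two_le
    split_ifs
    · have := hM (p * i - j) (by omega)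
      rw [dist_zero_right] at this
      exact this.le
    · simpa using hε.le

end DworkHasse

namespace DworkHasse

open Finset Function

/-! ### Orbits of a permutation -/

section Orbits

variable {ι : Type*} {c : ι → ℕ} {σ : Equiv.Perm ι}

open scoped Classical in
/-- The elements that minimize `c` in their orbit under `σ`. -/
noncomputable def orbitReps [Fintype ι] (c : ι → ℕ) (σ : Equiv.Perm ι) : Finset ι :=
  {i | ∀ k, c i ≤ c (σ^[k] i)}

theorem mem_periodicPts_perm [Finite ι] (σ : Equiv.Perm ι) (i : ι) : i ∈ periodicPts σ :=
  mk_mem_periodicPts (orderOf_pos σ) <| by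
    rw [IsPeriodicPt, IsFixedPt, Equiv.Perm.iterate_eq_pow, pow_orderOf_eq_one]
    rfl

theorem minimalPeriod_perm_pos [Finite ι] (σ : Equiv.Perm ι) (i : ι) : 0 < minimalPeriod σ i :=
  minimalPeriod_pos_of_mem_periodicPts (mem_periodicPts_perm σ i)

theorem exists_iterate_eq_of_iterate_eq [Finite ι] {i j : ι} {k : ℕ} (h : σ^[k] i = j) :
    ∃ l, σ^[l] j = i := by
  have hn := minimalPeriod_perm_pos σ i
  refine ⟨minimalPeriod σ i * k - k, ?_⟩
  rw [← h, ← iterate_add_apply, Nat.sub_add_cancel (Nat.le_mul_of_pos_left _ hn)]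
  exact ((isPeriodicPt_minimalPeriod σ i).mul_const k)

theorem mem_orbitReps [Fintype ι] {i : ι} : i ∈ orbitReps c σ ↔ ∀ k, c i ≤ c (σ^[k] i) := by
  simp [orbitReps]

theorem eq_of_mem_orbitReps [Fintype ι] (hc : Injective c) {i j : ι} (hi : i ∈ orbitReps c σ)
    (hj : j ∈ orbitReps c σ) {k : ℕ} (h : σ^[k] i = j) : i = j := by
  obtain ⟨l, hl⟩ := exists_iterate_eq_of_iterate_eq h
  refine hc (le_antisymm ?_ ?_)
  · rw [← h]
    exact mem_orbitReps.1 hi k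
  · conv_rhs => rw [← hl]
    exact mem_orbitReps.1 hj l

theorem exists_mem_orbitReps [Fintype ι] (c : ι → ℕ) (σ : Equiv.Perm ι) (x : ι) :
    ∃ i ∈ orbitReps c σ, ∃ k < minimalPeriod σ i, σ^[k] i = x := by
  obtain ⟨m, hm⟩ := exists_minimalFor_of_wellFoundedLT (fun _ => True) (fun k => c (σ^[k] x))
    ⟨0, trivial⟩
  obtain ⟨l, hl⟩ := exists_iterate_eq_of_iterate_eq (rfl : σ^[m] x = _)
  refine ⟨σ^[m] x, mem_orbitReps.2 fun k => ?_, l % minimalPeriod σ (σ^[m] x),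
    Nat.mod_lt _ (minimalPeriod_perm_pos _ _), ?_⟩
  · rw [← iterate_add_apply]
    rcases le_total (c (σ^[m] x)) (c (σ^[k + m] x)) with h | h
    · exact h
    · exact hm.2 trivial h
  · rw [iterate_mod_minimalPeriod_eq, hl]

theorem bijOn_orbits [Fintype ι] (hc : Injective c) (σ : Equiv.Perm ι) :
    Set.BijOn (fun x : (_ : ι) × ℕ => σ^[x.2] x.1)
      ((orbitReps c σ).sigma fun i => range (minimalPeriod σ i)) (univ : Finset ι) := by
  refine ⟨fun _ _ => mem_coe.2 (mem_univ _), ?_, ?_⟩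
  · rintro ⟨i, k⟩ hx ⟨j, l⟩ hy h
    simp only [mem_coe, mem_sigma, mem_range] at hx hy h
    obtain ⟨m, hm⟩ := exists_iterate_eq_of_iterate_eq (rfl : σ^[k] i = _)
    rw [h, ← iterate_add_apply] at hm
    obtain rfl := eq_of_mem_orbitReps hc hy.1 hx.1 hm
    rw [(iterate_eq_iterate_iff_of_lt_minimalPeriod hx.2 hy.2).1 h]
  · intro x _
    obtain ⟨i, hi, k, hk, rfl⟩ := exists_mem_orbitReps c σ x
    exact ⟨⟨i, k⟩, by simpa using ⟨hi, hk⟩, rfl⟩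

@[to_additive]
theorem prod_orbits [Fintype ι]
    {M : Type*} [CommMonoid M] (hc : Injective c) (σ : Equiv.Perm ι) (F : ι → M) :
    ∏ i, F i = ∏ i ∈ orbitReps c σ, ∏ k ∈ range (minimalPeriod σ i), F (σ^[k] i) := by
  rw [prod_sigma']
  have h := bijOn_orbits hc σ
  exact (prod_nbij _ h.mapsTo h.injOn h.surjOn fun _ _ => rfl).symm

theorem sum_minimalPeriod [Fintype ι] (hc : Injective c) (σ : Equiv.Perm ι) :
    ∑ i ∈ orbitReps c σ, minimalPeriod σ i = Fintype.card ι := by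
  have := sum_orbits hc σ fun _ => 1
  simpa using this.symm

theorem card_support_cycleOf [Fintype ι] [DecidableEq ι] {i : ι} (hi : σ i ≠ i) :
    #(σ.cycleOf i).support = minimalPeriod σ i := by
  have : (σ.cycleOf i).support = (range (minimalPeriod σ i)).image fun k => σ^[k] i := by
    ext j
    rw [Equiv.Perm.mem_support_cycleOf_iff' hi, mem_image]
    constructor
    · intro h
      obtain ⟨k, -, -, hk⟩ := h.exists_pow_eq σ
      refine ⟨k % minimalPeriod σ i, mem_range.2 (Nat.mod_lt _ (minimalPeriod_perm_pos _ _)), ?_⟩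
      rw [iterate_mod_minimalPeriod_eq, Equiv.Perm.iterate_eq_pow, hk]
    · rintro ⟨k, -, rfl⟩
      exact ⟨k, by rw [Equiv.Perm.iterate_eq_pow]; simp⟩
  rw [this, card_image_of_injOn, card_range]
  intro k hk l hl h
  exact iterate_injOn_Iio_minimalPeriod (by simpa using hk) (by simpa using hl) h

theorem sign_eq_prod_orbitReps [Fintype ι] [DecidableEq ι] (hc : Injective c) (σ : Equiv.Perm ι) :
    Equiv.Perm.sign σ = ∏ i ∈ orbitReps c σ, (-1) ^ (minimalPeriod σ i - 1) := by
  classical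
  rw [Equiv.Perm.sign_of_cycleType', Equiv.Perm.cycleType_def, Multiset.map_map]
  change ∏ x ∈ σ.cycleFactorsFinset, _ = _
  rw [← prod_filter_mul_prod_filter_not (orbitReps c σ) fun i => σ i ≠ i]
  rw [prod_eq_one (s := {i ∈ orbitReps c σ | ¬σ i ≠ i}), mul_one]
  · symm
    refine prod_nbij (fun i => σ.cycleOf i) ?_ ?_ ?_ ?_
    · intro i hi
      rw [Equiv.Perm.cycleOf_mem_cycleFactorsFinset_iff, Equiv.Perm.mem_support]
      exact (mem_filter.1 hi).2
    · intro i hi j hj h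
      rw [mem_coe, mem_filter] at hi hj
      have : σ.SameCycle i j := by
        have h1 : j ∈ (σ.cycleOf i).support := by
          simp only at h
          rw [h, Equiv.Perm.mem_support_cycleOf_iff' hj.2]
        exact (Equiv.Perm.mem_support_cycleOf_iff' hi.2).1 h1
      obtain ⟨k, -, -, hk⟩ := this.exists_pow_eq σ
      rw [← Equiv.Perm.iterate_eq_pow] at hk
      exact eq_of_mem_orbitReps hc hi.1 hj.1 hk
    · intro g hg
      rw [mem_coe] at hg
      obtain ⟨x, hx⟩ := (Equiv.Perm.mem_cycleFactorsFinset_iff.1 hg).1.nonempty_support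
      obtain ⟨i, hi, k, -, hk⟩ := exists_mem_orbitReps c σ x
      have hgx := Equiv.Perm.cycle_is_cycleOf hx hg
      have hsame : σ.SameCycle i x := ⟨k, by rw [← hk, Equiv.Perm.iterate_eq_pow]; simp⟩
      refine ⟨i, ?_, hsame.cycleOf_eq.trans hgx.symm⟩
      rw [mem_coe, mem_filter]
      refine ⟨hi, fun h => ?_⟩
      have hσx : x ∈ σ.support := Equiv.Perm.mem_cycleFactorsFinset_support_le hg hx
      rw [← hsame.mem_support_iff, Equiv.Perm.mem_support] at hσx
      exact hσx h
    · intro i hi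
      rw [mem_filter] at hi
      rw [Function.comp_apply, Function.comp_apply, card_support_cycleOf hi.2]
      obtain ⟨m, hm⟩ : ∃ m, minimalPeriod σ i = m + 1 :=
        ⟨minimalPeriod σ i - 1, by have := minimalPeriod_perm_pos σ i; omega⟩
      rw [hm, Nat.add_sub_cancel, pow_succ]
      simp
  · intro i hi
    rw [mem_filter, not_not] at hi
    rw [minimalPeriod_eq_one_iff_isFixedPt.2 hi.2]
    rfl

end Orbits

/-! ### Closed systems of digits -/

section Systems

variable {ι : Type*} {c : ι → ℕ} {σ τ : Equiv.Perm ι} {D : Finset ℕ} {p : ℕ}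
  {u v : ι → D → ℕ}

/-- The pair formed by the period of `i` under `σ` and the tuple whose digits are the values of `u`
along the orbit of `i`. -/
noncomputable def orbitDatum (D : Finset ℕ) (p : ℕ) (σ : Equiv.Perm ι) (u : ι → D → ℕ) (i : ι) :
    ℕ × (D → ℕ) :=
  (minimalPeriod σ i, tupleHorner D p (fun k => u (σ^[k] i)) (minimalPeriod σ i))

open scoped Classical in
/-- The tuples attached to the orbits of `σ`. -/
noncomputable def orbitData [Fintype ι] (D : Finset ℕ) (p : ℕ) (c : ι → ℕ) (σ : Equiv.Perm ι)
    (u : ι → D → ℕ) : Finset (ℕ × (D → ℕ)) :=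
  (orbitReps c σ).image (orbitDatum D p σ u)

/-- The relations `∑_d d u_{i,d} = p c_i - c_{σ i}`. -/
def IsClosedSystem (D : Finset ℕ) (p : ℕ) (c : ι → ℕ) (σ : Equiv.Perm ι) (u : ι → D → ℕ) : Prop :=
  ∀ i, dot D (u i) + c (σ i) = p * c i

theorem IsClosedSystem.iterate (h : IsClosedSystem D p c σ u) (i : ι) (k : ℕ) :
    dot D (u (σ^[k] i)) + c (σ^[k + 1] i) = p * c (σ^[k] i) := by
  rw [iterate_succ_apply']
  exact h _

theorem IsClosedSystem.mul_density_le_sum_orbit [Fintype ι] (hp : 1 < p) (hpos : ∀ i, 0 < c i)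
    (h : IsClosedSystem D p c σ u) (i : ι) :
    (minimalPeriod σ i : ℝ) * (((p : ℝ) - 1) * density D p) ≤
      (∑ k ∈ range (minimalPeriod σ i), tupleWeight D p (u (σ^[k] i)) : ℕ) :=
  mul_density_le_sum (w := fun k => u (σ^[k] i)) (c := fun k => c (σ^[k] i)) hp
    (h.iterate i) (minimalPeriod_perm_pos σ i)
    (by simp only [iterate_minimalPeriod, iterate_zero, id]) (hpos _)

theorem IsClosedSystem.card_mul_density_le [Fintype ι]
    (hp : 1 < p) (hc : Injective c) (hpos : ∀ i, 0 < c i)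
    (h : IsClosedSystem D p c σ u) :
    (Fintype.card ι : ℝ) * (((p : ℝ) - 1) * density D p) ≤
      (∑ i, tupleWeight D p (u i) : ℕ) := by
  rw [sum_orbits hc σ, ← sum_minimalPeriod hc σ, Nat.cast_sum, Nat.cast_sum, sum_mul]
  exact sum_le_sum fun i _ => h.mul_density_le_sum_orbit hp hpos i

theorem IsClosedSystem.sum_orbit_eq [Fintype ι]
    (hp : 1 < p) (hc : Injective c) (hpos : ∀ i, 0 < c i)
    (h : IsClosedSystem D p c σ u)
    (hmin : ((∑ i, tupleWeight D p (u i) : ℕ) : ℝ) =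
      (Fintype.card ι : ℝ) * (((p : ℝ) - 1) * density D p)) {i : ι} (hi : i ∈ orbitReps c σ) :
    ((∑ k ∈ range (minimalPeriod σ i), tupleWeight D p (u (σ^[k] i)) : ℕ) : ℝ) =
      (minimalPeriod σ i : ℝ) * (((p : ℝ) - 1) * density D p) := by
  rw [sum_orbits hc σ, ← sum_minimalPeriod hc σ, Nat.cast_sum, Nat.cast_sum, sum_mul] at hmin
  exact ((sum_eq_sum_iff_of_le fun i _ => h.mul_density_le_sum_orbit hp hpos i).1 hmin.symm
    i hi).symm

theorem IsClosedSystem.phiSeq_orbitDatum [Fintype ι] (hp : 1 < p) (h : IsClosedSystem D p c σ u)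
    (hu : ∀ i d, u i d < p) (i : ι) (m : ℕ) :
    phiSeq D p (orbitDatum D p σ u i).1 (orbitDatum D p σ u i).2 m = c (σ^[m] i) :=
  phiSeq_tupleHorner (w := fun k => u (σ^[k] i)) (c := fun k => c (σ^[k] i)) hp
    (fun _ => hu _) (h.iterate i) (minimalPeriod_perm_pos σ i)
    (fun k => by simp only [iterate_add_minimalPeriod_eq])
    (fun k => by simp only [iterate_add_minimalPeriod_eq]) m

theorem IsClosedSystem.support_orbitDatum [Fintype ι] (hp : 1 < p) (h : IsClosedSystem D p c σ u)
    (hu : ∀ i d, u i d < p) (i : ι) :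
    support D p (orbitDatum D p σ u i).1 (orbitDatum D p σ u i).2 =
      (range (minimalPeriod σ i)).image fun k => c (σ^[k] i) := by
  refine image_congr fun k _ => ?_
  exact h.phiSeq_orbitDatum hp hu i k

theorem orbitDatum_mem_MIStar [Fintype ι] (hp : 1 < p) (hc : Injective c) (hpos : ∀ i, 0 < c i)
    (h : IsClosedSystem D p c σ u) (hu : ∀ i d, u i d < p)
    (hmin : ((∑ i, tupleWeight D p (u i) : ℕ) : ℝ) =
      (Fintype.card ι : ℝ) * (((p : ℝ) - 1) * density D p)) {i : ι} (hi : i ∈ orbitReps c σ) :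
    orbitDatum D p σ u i ∈ MIStar D p := by
  have hn := minimalPeriod_perm_pos σ i
  have hq : 1 < p ^ minimalPeriod σ i := Nat.one_lt_pow (by omega) hp
  have hdot := dot_tupleHorner_of_periodic (n := minimalPeriod σ i)
    (w := fun k => u (σ^[k] i)) (c := fun k => c (σ^[k] i))
    (h.iterate i) (by simp only [iterate_minimalPeriod, iterate_zero, id])
  have hp1 : (0 : ℝ) < (p : ℝ) - 1 := by
    have : (1 : ℝ) < p := by exact_mod_cast hp
    linarith
  have hn' : (0 : ℝ) < minimalPeriod σ i := by exact_mod_cast hn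
  refine ⟨⟨⟨fun d => ?_, ?_, ?_⟩, ?_, ?_⟩, ?_⟩
  · have : tupleHorner D p (fun k => u (σ^[k] i)) (minimalPeriod σ i) d < p ^ minimalPeriod σ i :=
      horner_lt (fun k => hu _ d) _
    exact Nat.le_sub_one_of_lt this
  · exact Dvd.intro _ hdot.symm
  · exact hdot ▸ Nat.mul_pos (by omega) (hpos _)
  · rw [orbitDatum, tupleDensity, tupleWeight_tupleHorner hp fun _ => hu _,
      h.sum_orbit_eq hp hc hpos hmin hi]
    field_simp
  · rw [h.support_orbitDatum hp hu, card_image_of_injOn, card_range]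
    · rfl
    · intro k hk l hl hkl
      exact iterate_injOn_Iio_minimalPeriod (by simpa using hk) (by simpa using hl) (hc hkl)
  · intro x hx
    rw [h.support_orbitDatum hp hu] at hx
    obtain ⟨k, -, rfl⟩ := mem_image.1 hx
    rw [h.phiSeq_orbitDatum hp hu]
    exact mem_orbitReps.1 hi k

theorem range_subset_sigmaSet [Fintype ι] (hp : 1 < p) (hc : Injective c) (hpos : ∀ i, 0 < c i)
    (h : IsClosedSystem D p c σ u) (hu : ∀ i d, u i d < p)
    (hmin : ((∑ i, tupleWeight D p (u i) : ℕ) : ℝ) =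
      (Fintype.card ι : ℝ) * (((p : ℝ) - 1) * density D p)) :
    Set.range c ⊆ sigmaSet D p := by
  rintro _ ⟨x, rfl⟩
  obtain ⟨i, hi, k, hk, rfl⟩ := exists_mem_orbitReps c σ x
  refine Set.mem_biUnion (x := orbitDatum D p σ u i)
    (orbitDatum_mem_MIStar hp hc hpos h hu hmin hi).1 ?_
  rw [h.support_orbitDatum hp hu, mem_coe, mem_image]
  exact ⟨k, mem_range.2 hk, rfl⟩

theorem mem_orbitData [Fintype ι] {x : ℕ × (D → ℕ)} :
    x ∈ orbitData D p c σ u ↔ ∃ i ∈ orbitReps c σ, orbitDatum D p σ u i = x := by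
  simp [orbitData]

theorem orbitDatum_injective [Fintype ι]
    (hp : 1 < p) (hc : Injective c) (h : IsClosedSystem D p c σ u)
    (hu : ∀ i d, u i d < p) : Injective (orbitDatum D p σ u) := by
  intro i j hij
  have hi := h.phiSeq_orbitDatum hp hu i 0
  have hj := h.phiSeq_orbitDatum hp hu j 0
  rw [hij] at hi
  exact hc (hi.symm.trans hj)

theorem orbitData_mem_partitions [Fintype ι] (hp : 1 < p) (hc : Injective c) (hpos : ∀ i, 0 < c i)
    (hrange : Set.range c = sigmaSet D p)
    (h : IsClosedSystem D p c σ u) (hu : ∀ i d, u i d < p)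
    (hmin : ((∑ i, tupleWeight D p (u i) : ℕ) : ℝ) =
      (Fintype.card ι : ℝ) * (((p : ℝ) - 1) * density D p)) :
    orbitData D p c σ u ∈ partitions D p := by
  refine ⟨fun x hx => ?_, ?_, ?_⟩
  · obtain ⟨i, hi, rfl⟩ := mem_orbitData.1 (mem_coe.1 hx)
    exact orbitDatum_mem_MIStar hp hc hpos h hu hmin hi
  · intro x hx y hy hxy
    obtain ⟨i, hi, rfl⟩ := mem_orbitData.1 (mem_coe.1 hx)
    obtain ⟨j, hj, rfl⟩ := mem_orbitData.1 (mem_coe.1 hy)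
    rw [onFun, Finset.disjoint_left, h.support_orbitDatum hp hu, h.support_orbitDatum hp hu]
    intro a ha hb
    obtain ⟨k, hk, rfl⟩ := mem_image.1 ha
    obtain ⟨l, hl, hkl⟩ := mem_image.1 hb
    have := (bijOn_orbits hc σ).injOn (x₁ := ⟨j, l⟩) (x₂ := ⟨i, k⟩)
      (by simpa using ⟨hj, by simpa using hl⟩)
      (by simpa using ⟨hi, by simpa using hk⟩) (hc hkl)
    simp only [Sigma.mk.injEq] at this
    exact hxy (by rw [this.1])
  · rw [← hrange]
    ext a
    simp only [Set.mem_iUnion, exists_prop, Set.mem_range]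
    constructor
    · rintro ⟨x, hx, ha⟩
      obtain ⟨i, hi, rfl⟩ := mem_orbitData.1 hx
      rw [h.support_orbitDatum hp hu, mem_coe, mem_image] at ha
      obtain ⟨k, -, rfl⟩ := ha
      exact ⟨_, rfl⟩
    · rintro ⟨x, rfl⟩
      obtain ⟨i, hi, k, hk, rfl⟩ := exists_mem_orbitReps c σ x
      refine ⟨_, mem_orbitData.2 ⟨i, hi, rfl⟩, ?_⟩
      rw [h.support_orbitDatum hp hu, mem_coe, mem_image]
      exact ⟨k, mem_range.2 hk, rfl⟩

/-- A closed system of digits is determined by the tuples attached to its orbits. -/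
theorem eq_of_orbitData_eq [Fintype ι] (hp : 1 < p) (hc : Injective c)
    (h : IsClosedSystem D p c σ u) (hu : ∀ i d, u i d < p)
    (h' : IsClosedSystem D p c τ v) (hv : ∀ i d, v i d < p)
    (heq : orbitData D p c σ u = orbitData D p c τ v) : σ = τ ∧ u = v := by
  have key : ∀ x, σ x = τ x ∧ u x = v x := by
    intro x
    obtain ⟨i, hi, k, hk, rfl⟩ := exists_mem_orbitReps c σ x
    have hmem : orbitDatum D p σ u i ∈ orbitData D p c τ v :=
      heq ▸ mem_orbitData.2 ⟨i, hi, rfl⟩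
    obtain ⟨j, -, hj⟩ := mem_orbitData.1 hmem
    have hphi : ∀ m, c (τ^[m] j) = c (σ^[m] i) := fun m => by
      rw [← h.phiSeq_orbitDatum hp hu, ← h'.phiSeq_orbitDatum hp hv, hj]
    obtain rfl : j = i := hc (hphi 0)
    have hiter : ∀ m, τ^[m] j = σ^[m] j := fun m => hc (hphi m)
    refine ⟨?_, ?_⟩
    · rw [← iterate_succ_apply' σ, ← hiter, ← hiter, ← iterate_succ_apply' τ]
    · have hper : minimalPeriod τ j = minimalPeriod σ j := congrArg Prod.fst hj
      have htup := congrArg Prod.snd hj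
      simp only [orbitDatum, hper] at htup
      funext d
      have := eq_of_horner_eq (fun m => hv (τ^[m] j) d) (fun m => hu (σ^[m] j) d)
        (congrFun htup d) k hk
      rw [← this, hiter]
  exact ⟨Equiv.ext fun x => (key x).1, funext fun x => (key x).2⟩

theorem phiSeq_mem_support {n : ℕ} (hn : 0 < n) {U : D → ℕ}
    (hper : ∀ k, phiSeq D p n U (k + n) = phiSeq D p n U k) (m : ℕ) :
    phiSeq D p n U m ∈ support D p n U ∧ phiSeq D p n U (m % n) = phiSeq D p n U m := by
  have h : phiSeq D p n U (m % n) = phiSeq D p n U m :=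
    (show Periodic (phiSeq D p n U) n from hper).map_mod_nat m
  exact ⟨mem_image.2 ⟨m % n, mem_range.2 (Nat.mod_lt _ hn), h⟩, h⟩

/-- Every partition of `Σ_{D,p}` into supports comes from a closed system of digits. -/
theorem exists_orbitData_eq [Fintype ι] (hp : 1 < p) (hc : Injective c)
    (hrange : Set.range c = sigmaSet D p) {𝒰 : Finset (ℕ × (D → ℕ))} (h𝒰 : 𝒰 ∈ partitions D p) :
    ∃ (σ : Equiv.Perm ι) (u : ι → D → ℕ), IsClosedSystem D p c σ u ∧ (∀ i d, u i d < p) ∧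
      ((∑ i, tupleWeight D p (u i) : ℕ) : ℝ) =
        (Fintype.card ι : ℝ) * (((p : ℝ) - 1) * density D p) ∧
      orbitData D p c σ u = 𝒰 := by
  obtain ⟨hsub, hdisj, hunion⟩ := h𝒰
  have hMI : ∀ x ∈ 𝒰, x.2 ∈ MI D p x.1 := fun x hx => (hsub (mem_coe.2 hx)).1
  choose! w hw hwper hwU hphiper hphipos hphi using fun x hx => exists_digits hp (hMI x hx).1
  have hn : ∀ x ∈ 𝒰, 0 < x.1 := by
    rintro ⟨n, U⟩ hx
    rcases Nat.eq_zero_or_pos n with rfl | hn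
    · have h := (hMI _ hx).1.2.2
      have h0 : ∀ d, U d = 0 := by simpa using (hMI _ hx).1.1
      simp [dot, h0] at h
    · exact hn
  have hinj : ∀ x ∈ 𝒰, Set.InjOn (phiSeq D p x.1 x.2) (range x.1) := fun x hx =>
    card_image_iff.1 (by rw [card_range]; exact (hMI x hx).2.2)
  have hex : ∀ i, ∃ x ∈ 𝒰, ∃ k < x.1, phiSeq D p x.1 x.2 k = c i := by
    intro i
    have hi : c i ∈ sigmaSet D p := hrange ▸ Set.mem_range_self i
    rw [← hunion] at hi
    simp only [Set.mem_iUnion, exists_prop] at hi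
    obtain ⟨x, hx, hi⟩ := hi
    obtain ⟨k, hk, hki⟩ := mem_image.1 (mem_coe.1 hi)
    exact ⟨x, hx, k, mem_range.1 hk, hki⟩
  choose X hX κ hκ hXκ using hex
  have hlift : ∀ x ∈ 𝒰, ∀ m, ∃ i, c i = phiSeq D p x.1 x.2 m := by
    intro x hx m
    have : phiSeq D p x.1 x.2 m ∈ sigmaSet D p := by
      rw [← hunion]
      exact Set.mem_biUnion (mem_coe.2 hx)
        (mem_coe.2 (phiSeq_mem_support (hn x hx) (hphiper x hx) m).1)
    rw [← hrange] at this
    exact this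
  choose s hs using fun i => hlift (X i) (hX i) (κ i + 1)
  have key : ∀ x ∈ 𝒰, ∀ m i, c i = phiSeq D p x.1 x.2 m →
      w (X i) (κ i) = w x m ∧ c (s i) = phiSeq D p x.1 x.2 (m + 1) := by
    intro x hx m i hi
    have hsupp := phiSeq_mem_support (hn x hx) (hphiper x hx) m
    have hXx : X i = x := by
      by_contra hne
      have hd := Finset.disjoint_left.1 (hdisj (mem_coe.2 (hX i)) (mem_coe.2 hx) hne)
      refine hd (?_ : c i ∈ _) (hi ▸ hsupp.1)
      rw [← hXκ]
      exact mem_image.2 ⟨κ i, mem_range.2 (hκ i), rfl⟩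
    have hκm : κ i = m % x.1 := by
      refine hinj x hx (mem_coe.2 (mem_range.2 (hXx ▸ hκ i)))
        (mem_coe.2 (mem_range.2 (Nat.mod_lt _ (hn x hx)))) ?_
      rw [hsupp.2, ← hi, ← hXκ, hXx]
    have hwmod : ∀ m, w x (m % x.1) = w x m := fun m =>
      (show Periodic (w x) x.1 from hwper x hx).map_mod_nat m
    refine ⟨by rw [hXx, hκm, hwmod], ?_⟩
    have h1 := hphi x hx (κ i)
    have h2 := hphi x hx m
    have h3 : w x (κ i) = w x m := by rw [hκm, hwmod]
    have h4 : phiSeq D p x.1 x.2 (κ i) = phiSeq D p x.1 x.2 m := by rw [hκm, hsupp.2]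
    rw [h3, h4] at h1
    rw [hs, hXx]
    omega
  have hsurj : Surjective s := by
    intro y
    obtain ⟨i, hi⟩ := hlift (X y) (hX y) (κ y + ((X y).1 - 1))
    refine ⟨i, hc ?_⟩
    have := hn _ (hX y)
    rw [(key _ (hX y) _ i hi).2, ← hXκ y, add_assoc, Nat.sub_add_cancel this, hphiper _ (hX y)]
  let σ : Equiv.Perm ι := Equiv.ofBijective s (Finite.injective_iff_bijective.1
    (Finite.injective_iff_surjective.2 hsurj))
  let u : ι → D → ℕ := fun i => w (X i) (κ i)
  have hu : ∀ i d, u i d < p := fun i d => hw _ (hX i) _ d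
  have hsys : IsClosedSystem D p c σ u := by
    intro i
    change dot D (w (X i) (κ i)) + c (s i) = p * c i
    rw [hs, ← hXκ i]
    exact hphi _ (hX i) _
  have hiter : ∀ x ∈ 𝒰, ∀ i, c i = phiSeq D p x.1 x.2 0 →
      ∀ m, c (σ^[m] i) = phiSeq D p x.1 x.2 m := by
    intro x hx i hi m
    induction m with
    | zero => exact hi
    | succ m ih =>
      rw [iterate_succ_apply']
      exact (key x hx m _ ih).2
  have hdatum : ∀ x ∈ 𝒰, ∀ i, c i = phiSeq D p x.1 x.2 0 →
      i ∈ orbitReps c σ ∧ orbitDatum D p σ u i = x := by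
    intro x hx i hi
    have hci := hiter x hx i hi
    have hx0 := hn x hx
    have hperiod : minimalPeriod σ i = x.1 := by
      have h1 : IsPeriodicPt σ x.1 i := hc (by
        have := hphiper x hx 0
        rw [zero_add] at this
        rw [hci, this, hi])
      refine le_antisymm (h1.minimalPeriod_le hx0) ?_
      by_contra! hlt
      have h2 := hci (minimalPeriod σ i)
      rw [iterate_minimalPeriod, hi] at h2
      have := hinj x hx (mem_coe.2 (mem_range.2 hx0)) (mem_coe.2 (mem_range.2 hlt)) h2
      have := minimalPeriod_perm_pos σ i
      omega
    refine ⟨mem_orbitReps.2 fun k => ?_, ?_⟩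
    · rw [hci, hi]
      exact (hsub (mem_coe.2 hx)).2 _ (phiSeq_mem_support hx0 (hphiper x hx) k).1
    · rw [orbitDatum, hperiod]
      refine Prod.ext rfl ?_
      conv_rhs => rw [← hwU x hx]
      simp only
      congr 1
      funext k
      exact (key x hx k _ (hci k)).1
  have hdata : orbitData D p c σ u = 𝒰 := by
    ext x
    rw [mem_orbitData]
    constructor
    · rintro ⟨i, hi, rfl⟩
      obtain ⟨j, hj⟩ := hlift (X i) (hX i) 0
      have h1 := hdatum _ (hX i) j hj
      have h2 := hiter _ (hX i) j hj (κ i)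
      rw [hXκ] at h2
      obtain rfl := eq_of_mem_orbitReps hc h1.1 hi (hc h2)
      rw [h1.2]
      exact hX _
    · intro hx
      obtain ⟨i, hi⟩ := hlift x hx 0
      exact ⟨i, hdatum x hx i hi⟩
  refine ⟨σ, u, hsys, hu, ?_, hdata⟩
  have hp1 : (0 : ℝ) < (p : ℝ) - 1 := by
    have : (1 : ℝ) < p := by exact_mod_cast hp
    linarith
  rw [sum_orbits hc σ, ← sum_minimalPeriod hc σ, Nat.cast_sum, Nat.cast_sum, sum_mul]
  refine sum_congr rfl fun i hi => ?_
  have hmem : orbitDatum D p σ u i ∈ 𝒰 := hdata ▸ mem_orbitData.2 ⟨i, hi, rfl⟩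
  have hdens := (hMI _ hmem).2.1
  have hn' : (0 : ℝ) < minimalPeriod σ i := by exact_mod_cast minimalPeriod_perm_pos σ i
  rw [orbitDatum, tupleDensity, tupleWeight_tupleHorner hp fun _ => hu _] at hdens
  rw [← hdens]
  field_simp

/-! ### The terms of the Hasse polynomial -/

theorem aeval_hasseTerm_orbitDatum {K : Type*} [Field K] [CharZero K] (hp : 1 < p)
    (hu : ∀ i d, u i d < p) (a : D → K) (i : ι) :
    MvPolynomial.aeval a (hasseTerm D p (orbitDatum D p σ u i).2) =
      ∏ k ∈ range (minimalPeriod σ i),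
        ∏ d : D, (a d ^ u (σ^[k] i) d / ((u (σ^[k] i) d).factorial : K)) := by
  rw [prod_comm, hasseTerm, map_mul, MvPolynomial.aeval_C, map_inv₀, map_prod, map_prod,
    ← prod_inv_distrib, ← prod_mul_distrib]
  refine prod_congr rfl fun d _ => ?_
  simp only [orbitDatum, tupleHorner]
  rw [weight_horner hp fun k => hu _ d, digitFactorial_horner hp fun k => hu _ d]
  simp [div_eq_mul_inv, prod_mul_distrib, prod_pow_eq_pow_sum, mul_comm]

theorem sign_mul_prod_eq [Fintype ι] [DecidableEq ι] {K : Type*} [Field K] [CharZero K] (hp : 1 < p)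
    (hc : Injective c) (h : IsClosedSystem D p c σ u) (hu : ∀ i d, u i d < p) (a : D → K) :
    ((Equiv.Perm.sign σ : ℤ) : K) * ∏ i, ∏ d : D, (a d ^ u i d / ((u i d).factorial : K)) =
      MvPolynomial.aeval a ((-1) ^ (∑ x ∈ orbitData D p c σ u, (x.1 - 1)) *
        ∏ x ∈ orbitData D p c σ u, hasseTerm D p x.2) := by
  classical
  have hinj := (orbitDatum_injective hp hc h hu).injOn (s := (orbitReps c σ : Set ι))
  rw [sign_eq_prod_orbitReps hc σ, prod_orbits hc σ, orbitData, sum_image hinj, prod_image hinj,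
    map_mul, map_prod, map_pow, map_neg, map_one, ← prod_pow_eq_pow_sum]
  congr 1
  · simp [orbitDatum]
  · exact prod_congr rfl fun i _ => (aeval_hasseTerm_orbitDatum hp hu a i).symm

end Systems

end DworkHasse

namespace DworkHasse

open Finset Filter

/-! ### Expansion of the principal minors -/

section Minors

variable {K : Type*} [NormedField K] [CharZero K] {p : ℕ} {D : Finset ℕ}

/-- The term of a principal minor of `A_1` attached to a permutation and a system of exponents. -/
noncomputable def minorTerm (p : ℕ) (ϖ : K) (D : Finset ℕ) (a : D → K) {S : Finset ℕ+}
    (x : Equiv.Perm S × (S → D → ℕ)) : K :=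
  ((Equiv.Perm.sign x.1 : ℤ) : K) *
    ∏ i, ∏ d : D, (a d ^ x.2 i d * PowerSeries.coeff (x.2 i d) (theta p ϖ))

open scoped Classical in
/-- The closed systems on `S` with exponents less than `B`. -/
noncomputable def closedSystems (D : Finset ℕ) (p B : ℕ) (S : Finset ℕ+) :
    Finset (Equiv.Perm S × (S → D → ℕ)) :=
  {x ∈ univ ×ˢ Fintype.piFinset fun _ : S => Fintype.piFinset fun _ : D => range B |
    IsClosedSystem D p (fun i : S => ((i : ℕ+) : ℕ)) x.1 x.2}

theorem mem_closedSystems {B : ℕ} {S : Finset ℕ+} {x : Equiv.Perm S × (S → D → ℕ)} :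
    x ∈ closedSystems D p B S ↔ (∀ i d, x.2 i d < B) ∧
      IsClosedSystem D p (fun i : S => ((i : ℕ+) : ℕ)) x.1 x.2 := by
  simp [closedSystems]

theorem A₁_apply_eq_sum (ϖ : K) (hpos : ∀ d ∈ D, 0 < d) (a : D → K) {i j : ℕ+} {B : ℕ}
    (hB : p * i < B) :
    A₁ p ϖ D a i j = ∑ v ∈ (Fintype.piFinset fun _ : D => range B) with dot D v + j = p * i,
      ∏ d : D, (a d ^ v d * PowerSeries.coeff (v d) (theta p ϖ)) := by
  rw [A₁_apply]
  split_ifs with h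
  · rw [coeff_F₁ ϖ hpos a (lt_of_le_of_lt (Nat.sub_le _ _) hB)]
    refine sum_congr (filter_congr fun v _ => ?_) fun _ _ => rfl
    omega
  · rw [filter_eq_empty_iff.2, sum_empty]
    intro v _
    omega

theorem det_submatrix_A₁ (ϖ : K) (hpos : ∀ d ∈ D, 0 < d) (a : D → K) {S : Finset ℕ+} {B : ℕ}
    (hB : ∀ i ∈ S, p * i < B) :
    ((A₁ p ϖ D a).submatrix (Subtype.val : S → ℕ+) Subtype.val).det =
      ∑ x ∈ closedSystems D p B S, minorTerm p ϖ D a x := by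
  classical
  rw [closedSystems, sum_filter, sum_product, ← Matrix.det_transpose, Matrix.det_apply']
  refine sum_congr rfl fun σ _ => ?_
  rw [← sum_filter]
  have : ∏ i : S, (((A₁ p ϖ D a).submatrix (Subtype.val : S → ℕ+) Subtype.val).transpose (σ i) i) =
      ∏ i : S, ∑ v ∈ (Fintype.piFinset fun _ : D => range B) with
        dot D v + (σ i : ℕ+) = p * (i : ℕ+),
        ∏ d : D, (a d ^ v d * PowerSeries.coeff (v d) (theta p ϖ)) :=
    prod_congr rfl fun i _ => A₁_apply_eq_sum ϖ hpos a (hB i i.2)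
  rw [this, prod_univ_sum, mul_sum]
  refine sum_congr ?_ fun u _ => rfl
  ext u
  rw [mem_filter, Fintype.mem_piFinset, Fintype.mem_piFinset]
  simp only [mem_filter, IsClosedSystem, forall_and]

variable {ϖ : K}

theorem norm_factor_le {a : K} (ha : ‖a‖ ≤ 1)
    (n : ℕ) : ‖a ^ n * PowerSeries.coeff n (theta p ϖ)‖ ≤ ‖PowerSeries.coeff n (theta p ϖ)‖ := by
  rw [norm_mul, norm_pow]
  exact mul_le_of_le_one_left (norm_nonneg _) (pow_le_one₀ (norm_nonneg _) ha)

theorem norm_minorTerm_le [IsUltrametricDist K] [Fact p.Prime]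
    (hpK : ‖(p : K)‖ < 1) (hϖ : ϖ ^ (p - 1) = -(p : K)) {a : D → K}
    (ha : ∀ d, ‖a d‖ ≤ 1) {S : Finset ℕ+} (x : Equiv.Perm S × (S → D → ℕ)) :
    ‖minorTerm p ϖ D a x‖ ≤ ‖ϖ‖ ^ ∑ i, tupleWeight D p (x.2 i) := by
  rw [minorTerm, norm_mul]
  refine (mul_le_of_le_one_left (norm_nonneg _)
    (IsUltrametricDist.norm_intCast_le_one K _)).trans ?_
  exact norm_prod_le_pow_sum _ fun i _ => norm_prod_le_pow_sum _ fun d _ =>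
    (norm_factor_le (ha d) _).trans (norm_coeff_theta_le hpK hϖ _)

theorem norm_minorTerm_le_of_le [IsUltrametricDist K] [Fact p.Prime]
    (hpK : ‖(p : K)‖ < 1) (hϖ : ϖ ^ (p - 1) = -(p : K)) {a : D → K}
    (ha : ∀ d, ‖a d‖ ≤ 1) {S : Finset ℕ+} (x : Equiv.Perm S × (S → D → ℕ)) {i₀ : S} {d₀ : D}
    (h : p ≤ x.2 i₀ d₀) :
    ‖minorTerm p ϖ D a x‖ ≤ ‖ϖ‖ ^ (∑ i, tupleWeight D p (x.2 i) + 1) := by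
  classical
  rw [minorTerm, norm_mul]
  refine (mul_le_of_le_one_left (norm_nonneg _)
    (IsUltrametricDist.norm_intCast_le_one K _)).trans ?_
  have hsum : ∑ i, tupleWeight D p (x.2 i) + 1 =
      ∑ i, ∑ d : D, (weight p (x.2 i d) + if i = i₀ ∧ d = d₀ then 1 else 0) := by
    simp only [sum_add_distrib, ite_and, sum_ite_eq', mem_univ, if_true, sum_ite_irrel, tupleWeight,
      sum_const_zero]
  rw [hsum]
  refine norm_prod_le_pow_sum _ fun i _ => norm_prod_le_pow_sum _ fun d _ =>
    (norm_factor_le (ha d) _).trans ?_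
  split_ifs with hid
  · obtain ⟨rfl, rfl⟩ := hid
    exact norm_coeff_theta_le_of_le hpK hϖ h
  · exact norm_coeff_theta_le hpK hϖ _

/-- A closed system is critical if its exponents are digits and it has the least possible weight. -/
def IsCritical (D : Finset ℕ) (p : ℕ) {S : Finset ℕ+} (u : S → D → ℕ) : Prop :=
  (∀ i d, u i d < p) ∧ ((∑ i, tupleWeight D p (u i) : ℕ) : ℝ) =
    (Fintype.card S : ℝ) * (((p : ℝ) - 1) * density D p)

theorem norm_minorTerm_le_of_not_isCritical [IsUltrametricDist K] [Fact p.Prime]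
    (hpK : ‖(p : K)‖ < 1) (hϖ : ϖ ^ (p - 1) = -(p : K))
    {a : D → K} (ha : ∀ d, ‖a d‖ ≤ 1) {S : Finset ℕ+} {x : Equiv.Perm S × (S → D → ℕ)}
    (hx : IsClosedSystem D p (fun i : S => ((i : ℕ+) : ℕ)) x.1 x.2) (hcrit : ¬IsCritical D p x.2) :
    ‖minorTerm p ϖ D a x‖ ≤
      ‖ϖ‖ ^ (⌊(Fintype.card S : ℝ) * (((p : ℝ) - 1) * density D p)⌋₊ + 1) := by
  have hp := (Fact.out : p.Prime).one_lt
  have hϖ1 := (norm_uniformizer_lt_one hpK hϖ).le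
  have hle := hx.card_mul_density_le hp
    (fun i j h => Subtype.ext (PNat.coe_injective h)) (fun i => PNat.pos _)
  set W := ∑ i, tupleWeight D p (x.2 i)
  set r := (Fintype.card S : ℝ) * (((p : ℝ) - 1) * density D p)
  have hfloor : ⌊r⌋₊ ≤ W := by simpa using Nat.floor_mono hle
  by_cases hdig : ∀ i d, x.2 i d < p
  · have hne : (W : ℝ) ≠ r := fun h => hcrit ⟨hdig, h⟩
    refine (norm_minorTerm_le hpK hϖ ha x).trans
      (pow_le_pow_of_le_one (norm_nonneg _) hϖ1 ?_)
    by_contra hlt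
    have hW : W = ⌊r⌋₊ := by omega
    have hp1 : (1 : ℝ) < p := by exact_mod_cast hp
    have hr : 0 ≤ r :=
      mul_nonneg (Nat.cast_nonneg _) (mul_nonneg (by linarith) (density_nonneg D hp))
    exact hne (le_antisymm (hW ▸ Nat.floor_le hr) hle)
  · push Not at hdig
    obtain ⟨i, d, h⟩ := hdig
    exact (norm_minorTerm_le_of_le hpK hϖ ha x h).trans
      (pow_le_pow_of_le_one (norm_nonneg _) hϖ1 (by omega))

theorem minorTerm_of_isCritical [Fact p.Prime]
    (hϖ : ϖ ^ (p - 1) = -(p : K)) (a : D → K) {S : Finset ℕ+}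
    {x : Equiv.Perm S × (S → D → ℕ)} (hx : IsCritical D p x.2) :
    minorTerm p ϖ D a x =
      ((Equiv.Perm.sign x.1 : ℤ) : K) *
        (∏ i, ∏ d : D, (a d ^ x.2 i d / ((x.2 i d).factorial : K))) *
        ϖ ^ ⌊(Fintype.card S : ℝ) * (((p : ℝ) - 1) * density D p)⌋₊ := by
  have hp := (Fact.out : p.Prime).one_lt
  have hexp : ⌊(Fintype.card S : ℝ) * (((p : ℝ) - 1) * density D p)⌋₊ = ∑ i, ∑ d : D, x.2 i d := by
    rw [← hx.2, Nat.floor_natCast]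
    exact sum_congr rfl fun i _ => sum_congr rfl fun d _ => weight_of_lt hp (hx.1 i d)
  rw [minorTerm, hexp, mul_assoc]
  congr 1
  simp only [← prod_pow_eq_pow_sum, ← prod_mul_distrib]
  refine prod_congr rfl fun i _ => prod_congr rfl fun d _ => ?_
  rw [coeff_theta_of_lt hϖ (hx.1 i d)]
  ring

/-- The sum of the critical terms is the value of the Hasse polynomial. -/
theorem sum_critical_eq [Fact p.Prime] {B : ℕ} (hB : p ≤ B) {S : Finset ℕ+} (a : D → K)
    (hrange : Set.range (fun i : S => ((i : ℕ+) : ℕ)) = sigmaSet D p)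
    [DecidablePred fun x : Equiv.Perm S × (S → D → ℕ) => IsCritical D p x.2] :
    ∑ x ∈ closedSystems D p B S with IsCritical D p x.2, ((Equiv.Perm.sign x.1 : ℤ) : K) *
        (∏ i, ∏ d : D, (a d ^ x.2 i d / ((x.2 i d).factorial : K))) =
      MvPolynomial.aeval a (hassePoly D p) := by
  have hp := (Fact.out : p.Prime).one_lt
  have hc : Function.Injective (fun i : S => ((i : ℕ+) : ℕ)) :=
    fun i j h => Subtype.ext (PNat.coe_injective h)
  rw [hassePoly, finsum_mem_eq_finite_toFinset_sum _ (partitions_finite D p), map_sum]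
  refine sum_nbij (fun x => orbitData D p (fun i : S => ((i : ℕ+) : ℕ)) x.1 x.2) ?_ ?_ ?_ ?_
  · intro x hx
    rw [mem_filter, mem_closedSystems] at hx
    rw [Set.Finite.mem_toFinset]
    exact orbitData_mem_partitions hp hc (fun i => PNat.pos _) hrange hx.1.2 hx.2.1 hx.2.2
  · intro x hx y hy h
    rw [mem_coe, mem_filter, mem_closedSystems] at hx hy
    have := eq_of_orbitData_eq hp hc hx.1.2 hx.2.1 hy.1.2 hy.2.1 h
    exact Prod.ext this.1 this.2
  · intro 𝒰 h𝒰
    rw [mem_coe, Set.Finite.mem_toFinset] at h𝒰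
    obtain ⟨σ, u, h1, h2, h3, h4⟩ := exists_orbitData_eq hp hc hrange h𝒰
    refine ⟨(σ, u), ?_, h4⟩
    rw [mem_coe, mem_filter, mem_closedSystems]
    exact ⟨⟨fun i d => (h2 i d).trans_le hB, h1⟩, h2, h3⟩
  · intro x hx
    rw [mem_filter, mem_closedSystems] at hx
    exact sign_mul_prod_eq hp hc hx.1.2 hx.2.1 a

/-- The set `Σ_{D,p}` as a finite set of positive integers. -/
noncomputable def sigmaFinset (D : Finset ℕ) (p : ℕ) : Finset ℕ+ :=
  ((sigmaSet_finite D p).preimage PNat.coe_injective.injOn).toFinset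

theorem mem_sigmaFinset {i : ℕ+} : i ∈ sigmaFinset D p ↔ (i : ℕ) ∈ sigmaSet D p := by
  simp [sigmaFinset]

theorem range_sigmaFinset (hp : 1 < p) :
    Set.range (fun i : sigmaFinset D p => ((i : ℕ+) : ℕ)) = sigmaSet D p := by
  ext v
  constructor
  · rintro ⟨i, rfl⟩
    exact mem_sigmaFinset.1 i.2
  · intro hv
    have hv0 : 0 < v := by
      simp only [sigmaSet, Set.mem_iUnion, exists_prop] at hv
      obtain ⟨x, hx, hv⟩ := hv
      obtain ⟨k, -, rfl⟩ := mem_image.1 (mem_coe.1 hv)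
      obtain ⟨-, -, -, -, -, h, -⟩ := exists_digits hp hx.1
      exact h k
    exact ⟨⟨⟨v, hv0⟩, mem_sigmaFinset.2 hv⟩, rfl⟩

theorem card_sigmaFinset (hp : 1 < p) : #(sigmaFinset D p) = sigmaCard D p := by
  rw [sigmaCard, ← range_sigmaFinset hp, ← Set.image_univ, Set.ncard_image_of_injective _
    fun i j h => Subtype.ext (PNat.coe_injective h), Set.ncard_univ, Nat.card_eq_fintype_card,
    Fintype.card_coe]

/-- The principal minors of size `N_{D,p}` of `A_1`, up to terms of higher order. -/
theorem norm_det_submatrix_A₁_sub_le [IsUltrametricDist K] [Fact p.Prime]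
    (hpK : ‖(p : K)‖ < 1) (hϖ : ϖ ^ (p - 1) = -(p : K))
    (hpos : ∀ d ∈ D, 0 < d) {a : D → K} (ha : ∀ d, ‖a d‖ ≤ 1) {S : Finset ℕ+}
    (hS : #S = sigmaCard D p) :
    ‖((A₁ p ϖ D a).submatrix (Subtype.val : S → ℕ+) Subtype.val).det -
      (if S = sigmaFinset D p then MvPolynomial.aeval a (hassePoly D p) *
        ϖ ^ ⌊(sigmaCard D p : ℝ) * ((p : ℝ) - 1) * density D p⌋₊ else 0)‖ ≤
      ‖ϖ‖ ^ (⌊(sigmaCard D p : ℝ) * ((p : ℝ) - 1) * density D p⌋₊ + 1) := by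
  classical
  have hp := (Fact.out : p.Prime).one_lt
  have hc : Function.Injective (fun i : S => ((i : ℕ+) : ℕ)) :=
    fun i j h => Subtype.ext (PNat.coe_injective h)
  have hB : ∀ i ∈ S, p * i < p * (∑ i ∈ S, (i : ℕ) + 1) := fun i hi =>
    Nat.mul_lt_mul_of_pos_left (Nat.lt_succ_of_le
      (single_le_sum (f := fun i : ℕ+ => (i : ℕ)) (fun _ _ => Nat.zero_le _) hi)) (by omega)
  have hcard : Fintype.card S = sigmaCard D p := by rw [Fintype.card_coe, hS]
  rw [det_submatrix_A₁ ϖ hpos a hB, mul_assoc, ← hcard,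
    ← sum_filter_add_sum_filter_not _ fun x => IsCritical D p x.2]
  have hcrit : ∑ x ∈ closedSystems D p (p * (∑ i ∈ S, (i : ℕ) + 1)) S with IsCritical D p x.2,
      minorTerm p ϖ D a x = if S = sigmaFinset D p then MvPolynomial.aeval a (hassePoly D p) *
        ϖ ^ ⌊(Fintype.card S : ℝ) * (((p : ℝ) - 1) * density D p)⌋₊ else 0 := by
    rw [sum_congr rfl fun x hx => minorTerm_of_isCritical hϖ a (mem_filter.1 hx).2, ← sum_mul]
    split_ifs with h
    · rw [sum_critical_eq (Nat.le_mul_of_pos_right p (Nat.succ_pos _)) a]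
      subst h
      exact range_sigmaFinset hp
    · rw [filter_eq_empty_iff.2, sum_empty, zero_mul]
      intro x hx hx'
      refine h (eq_of_subset_of_card_le (fun i hi => ?_) ?_)
      · exact mem_sigmaFinset.2 (range_subset_sigmaSet hp hc (fun i => PNat.pos _)
          (mem_closedSystems.1 hx).2 hx'.1 hx'.2 ⟨⟨i, hi⟩, rfl⟩)
      · rw [card_sigmaFinset hp, hS]
  rw [hcrit, add_sub_cancel_left]
  refine norm_sum_le_of_forall_norm_le (by positivity) fun x hx => ?_
  rw [mem_filter] at hx
  exact norm_minorTerm_le_of_not_isCritical hpK hϖ ha (mem_closedSystems.1 hx.1).2 hx.2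

theorem norm_coeff_sub_le [IsUltrametricDist K] [Fact p.Prime]
    (hpK : ‖(p : K)‖ < 1) (hϖ : ϖ ^ (p - 1) = -(p : K))
    (hpos : ∀ d ∈ D, 0 < d) {a : D → K} (ha : ∀ d, ‖a d‖ ≤ 1) {P : PowerSeries K}
    (hP : IsFredholmDet (A₁ p ϖ D a) P) :
    ‖PowerSeries.coeff (sigmaCard D p) P -
      (-1) ^ sigmaCard D p * MvPolynomial.aeval a (hassePoly D p) *
        ϖ ^ ⌊(sigmaCard D p : ℝ) * ((p : ℝ) - 1) * density D p⌋₊‖ ≤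
      ‖ϖ‖ ^ (⌊(sigmaCard D p : ℝ) * ((p : ℝ) - 1) * density D p⌋₊ + 1) := by
  have hp := (Fact.out : p.Prime).one_lt
  refine le_of_tendsto ((hP (sigmaCard D p)).sub_const _).norm ?_
  filter_upwards [eventually_ge_atTop (sigmaFinset D p)] with S hS
  rw [coeff_charpolyRev_submatrix, mul_assoc, ← mul_sub, norm_mul, norm_pow, norm_neg, norm_one,
    one_pow, one_mul]
  have hmem : sigmaFinset D p ∈ S.powersetCard (sigmaCard D p) :=
    mem_powersetCard.2 ⟨hS, card_sigmaFinset hp⟩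
  have : MvPolynomial.aeval a (hassePoly D p) *
        ϖ ^ ⌊(sigmaCard D p : ℝ) * ((p : ℝ) - 1) * density D p⌋₊ =
      ∑ s ∈ S.powersetCard (sigmaCard D p), if s = sigmaFinset D p then
        MvPolynomial.aeval a (hassePoly D p) *
          ϖ ^ ⌊(sigmaCard D p : ℝ) * ((p : ℝ) - 1) * density D p⌋₊ else 0 := by
    rw [sum_ite_eq', if_pos hmem]
  rw [this, ← sum_sub_distrib]
  exact norm_sum_le_of_forall_norm_le (by positivity) fun s hs =>
    norm_det_submatrix_A₁_sub_le hpK hϖ hpos ha (mem_powersetCard.1 hs).2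

end Minors

/-! ### The field of `p`-adic complex numbers -/

theorem norm_natCast_padicComplex_lt_one (p : ℕ) [Fact p.Prime] : ‖(p : ℂ_[p])‖ < 1 := by
  have h := PadicComplex.norm_extends' p (p : ℚ_[p])
  rw [map_natCast, PadicComplex.coe_natCast] at h
  rw [h]
  exact Padic.norm_p_lt_one

theorem norm_liftCoeff_le_one {p : ℕ} [Fact p.Prime] {k K : Type*} [Field k] [Finite k]
    [NormedField K] (j : WittVector p k →+* K) (D : Finset ℕ) (f : Polynomial k) (d : D) :
    ‖liftCoeff p j D f d‖ ≤ 1 := by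
  have := Fintype.ofFinite k
  have h : liftCoeff p j D f d ^ Fintype.card k = liftCoeff p j D f d := by
    rw [liftCoeff, ← map_pow, ← map_pow, FiniteField.pow_card]
  have hn := congrArg norm h
  rw [norm_pow] at hn
  by_contra! hlt
  exact (lt_self_pow₀ hlt Fintype.one_lt_card).ne' hn

theorem congrMod_of_norm_sub_le {K : Type*} [NormedField K] {ϖ x y : K} (hϖ : ϖ ≠ 0) {r : ℕ}
    (h : ‖x - y‖ ≤ ‖ϖ‖ ^ r) : CongrMod ϖ r x y := by
  refine ⟨(x - y) / ϖ ^ r, ?_, by rw [mul_div_cancel₀ _ (pow_ne_zero _ hϖ)]⟩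
  rw [norm_div, norm_pow]
  exact div_le_one_of_le₀ h (by positivity)

end DworkHasse

/-- For every `f` over a finite field `k` of characteristic `p` with exponents in `D`, the Fredholm
determinant `P = det(I - T A_1)` exists, and its coefficient of index `N = N_{D,p}` is congruent to
`(-1) ^ N H(A) π ^ e` modulo `π ^ (e + 1)`, with `e = N (p - 1) δ_{D,p}`. If `N (p - 1) δ_{D,p}` is
not an integer, then `e` is its integral part; in this case no partition of `Σ_{D,p}` into supports
exists and `H = 0`. -/
theorem proposition3p9 (p : ℕ) [Fact p.Prime] (D : Finset ℕ) (hD : D.Nonempty)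
    (hpos : ∀ d ∈ D, 0 < d)
    {k : Type*} [Field k] [Finite k] [CharP k p] (f : Polynomial k) (hf : f.support ⊆ D)
    (j : WittVector p k →+* ℂ_[p])
    (ϖ : ℂ_[p]) (hϖ : ϖ ^ (p - 1) = -(p : ℂ_[p])) :
    ∃ P : PowerSeries ℂ_[p],
      DworkHasse.IsFredholmDet (DworkHasse.A₁ p ϖ D (DworkHasse.liftCoeff p j D f)) P ∧
      DworkHasse.CongrMod ϖ
        (⌊(DworkHasse.sigmaCard D p : ℝ) * ((p : ℝ) - 1) * DworkHasse.density D p⌋₊ + 1)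
        (PowerSeries.coeff (DworkHasse.sigmaCard D p) P)
        ((-1) ^ DworkHasse.sigmaCard D p *
          MvPolynomial.aeval (DworkHasse.liftCoeff p j D f) (DworkHasse.hassePoly D p) *
          ϖ ^ ⌊(DworkHasse.sigmaCard D p : ℝ) * ((p : ℝ) - 1) * DworkHasse.density D p⌋₊) := by
  have hpK := DworkHasse.norm_natCast_padicComplex_lt_one p
  have ha := DworkHasse.norm_liftCoeff_le_one j D f
  have hϖ0 : ϖ ≠ 0 := by
    rintro rfl
    have hp := (Fact.out : p.Prime)
    rw [zero_pow (by have := hp.two_le; omega), zero_eq_neg] at hϖ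
    exact hp.ne_zero (Nat.cast_eq_zero.1 hϖ)
  obtain ⟨P, hP⟩ := DworkHasse.exists_isFredholmDet_A₁ hpK hϖ hpos ha
  exact ⟨P, hP, DworkHasse.congrMod_of_norm_sub_le hϖ0
    (DworkHasse.norm_coeff_sub_le hpK hϖ hpos ha hP)⟩
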